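/- **Definitions.** A concave composition of even length of an integer $n\ge 0$ is a representation $n=a_1+\cdots+a_m+b_m+\cdots+b_1$ by integers with $m\ge 1$ and $$a_1>a_2>\cdots>a_m=b_m<b_{m-1}<\cdots<b_1,\qquad a_m\ge 0.$$ A concave composition of odd length of type 1 of $n$ is a representation $n=a_1+\cdots+a_{m+1}+b_m+\cdots+b_1$ by integers with $m\ge 0$ and $$a_1>a_2>\cdots>a_{m+1}<b_m<b_{m-1}<\cdots<b_1,\qquad a_{m+1}\ge 0;$$ one of type 2 is defined in the same way, with $a_{m+1}\le b_m$ in place of $a_{m+1}<b_m$. (For $m=0$ it consists of the single part $a_1=n$.) Let $c_e(n)$, $co_1(n)$ and $co_2(n)$ be the numbers of concave compositions of $n$ of even length, of odd length of type 1 and of odd length of type 2, respectively. Let $co_1'(n)=co_1(n)-1$ if $n$ is a triangular number (that is, $n=k(k+1)/2$ for some integer $k\ge 0$), and $co_1'(n)=co_1(n)$ otherwise. For a function $f$ from the non-negative integers to the integers and a real number $X$, let $$E_f(r,a;X)=\#\{0\le n<X : f(n)\equiv r \pmod a\}.$$ **Theorem.** (i) There exists a constant $c>0$ such that, for all sufficiently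 large $X$, $E_{c_e}(0,4;X)>c\sqrt{X}$. (ii) There exist constants $c>0$ and $0<\alpha<1$ such that, for all sufficiently large $X$, $$E_{co_1'}(0,4;X)>\frac{X(\log X)^{\alpha}-cX}{\left(\sqrt{24X+1}+1\right)(\log X)^{\alpha}}.$$ (iii) There exists a constant $c>0$ such that, for all sufficiently large $X$, $E_{co_2}(0,2;X)>c\sqrt{X}$. -/

import Mathlib

namespace ConcaveComposition

/-- The concave compositions of even length of `n`. The pair `(a, b)` of lists
`a = [a₁, …, aₘ]`, `b = [b₁, …, bₘ]` with `m ≥ 1` stands for the composition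
`a₁ + ⋯ + aₘ + bₘ + ⋯ + b₁ = n`, where `a₁ > ⋯ > aₘ = bₘ < ⋯ < b₁` and `aₘ ≥ 0`. -/
def evenLength (n : ℕ) : Set (List ℕ × List ℕ) :=
  {p | p.1 ≠ [] ∧ p.1.length = p.2.length ∧
    p.1.Pairwise (· > ·) ∧ p.2.Pairwise (· > ·) ∧
    p.1.getLast? = p.2.getLast? ∧ p.1.sum + p.2.sum = n}

/-- The concave compositions of odd length of type 1 of `n`. The pair `(a, b)` of lists
`a = [a₁, …, aₘ₊₁]`, `b = [b₁, …, bₘ]` with `m ≥ 0` stands for the composition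
`a₁ + ⋯ + aₘ₊₁ + bₘ + ⋯ + b₁ = n`, where `a₁ > ⋯ > aₘ₊₁ < bₘ < ⋯ < b₁` and `aₘ₊₁ ≥ 0`. -/
def oddLengthOne (n : ℕ) : Set (List ℕ × List ℕ) :=
  {p | p.1.length = p.2.length + 1 ∧
    p.1.Pairwise (· > ·) ∧ p.2.Pairwise (· > ·) ∧
    (∀ x ∈ p.1.getLast?, ∀ y ∈ p.2.getLast?, x < y) ∧ p.1.sum + p.2.sum = n}

/-- The concave compositions of odd length of type 2 of `n`: as for type 1, except that the
central condition is `aₘ₊₁ ≤ bₘ` instead of `aₘ₊₁ < bₘ`. -/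
def oddLengthTwo (n : ℕ) : Set (List ℕ × List ℕ) :=
  {p | p.1.length = p.2.length + 1 ∧
    p.1.Pairwise (· > ·) ∧ p.2.Pairwise (· > ·) ∧
    (∀ x ∈ p.1.getLast?, ∀ y ∈ p.2.getLast?, x ≤ y) ∧ p.1.sum + p.2.sum = n}

/-- The number of concave compositions of even length of `n`. -/
noncomputable def ce (n : ℕ) : ℤ := ((evenLength n).ncard : ℤ)

/-- The number of concave compositions of odd length of type 1 of `n`. -/
noncomputable def coOne (n : ℕ) : ℤ := ((oddLengthOne n).ncard : ℤ)

/-- The number of concave compositions of odd length of type 2 of `n`. -/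
noncomputable def coTwo (n : ℕ) : ℤ := ((oddLengthTwo n).ncard : ℤ)

/-- Triangular numbers `0, 1, 3, 6, …`. -/
def IsTriangular (n : ℕ) : Prop := ∃ k : ℕ, n = k * (k + 1) / 2

open Classical in
/-- `coOne n`, diminished by `1` when `n` is triangular. -/
noncomputable def coOne' (n : ℕ) : ℤ := if IsTriangular n then coOne n - 1 else coOne n

/-- `E f r a X` is the number of integers `0 ≤ n < X` with `f n ≡ r (mod a)`. -/
noncomputable def E (f : ℕ → ℤ) (r a : ℤ) (X : ℝ) : ℕ :=
  {n : ℕ | (n : ℝ) < X ∧ f n ≡ r [ZMOD a]}.ncard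

end ConcaveComposition

namespace ConcaveComposition

section QSeries

open PowerSeries Finset
open scoped PowerSeries.WithPiTopology

/-! ### Power series in `q = X` -/

/-! Write `q` for the variable, `(q)_n` for `qPoch n` and `(q)_∞` for `euler`. Splitting a concave
composition at its central part gives the generating function `∑ q^(m²+em) / ((q)_m² (1 -
q^(2m+k)))`, with `(e, k) = (1, 2), (1, 1), (0, 1)` for `c_e`, `co_1`, `co_2`. Bailey pairs
(`tsum_bailey`, with `bailey_alphaOne`, `bailey_alphaTwo`, `bailey_alphaEven`) express its product
with `(q)_∞` through a sparse series with quadratic exponents.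

This produces an integral series `G` with `c_e = 2G` (for `n > 0`), `co_1' = 2G` or `co_2 = G`, such
that `G (q)_∞` has even coefficients off a sparse set, or, for `co_1'`, at every odd exponent. In
the latter case divisibility by 2 comes from Gauss' identity `triangleSeries_mul_euler`: both the
triangular series times `(q)_∞` and the Bailey series are congruent mod 2 to `(q⁴; q⁴)_∞`.

By the pentagonal number theorem the `n`-th coefficient of `G (q)_∞` is a signed sum of the
coefficients of `G` at `n - ω`, over the generalized pentagonal numbers `ω ≤ n`. If the number of
terms is odd and the sum is even, some term is even (`exists_even_coeff`). There are `(K+1)²`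
integers `n` with exactly `2k+1` such `ω` for some `k ≤ K`, and an even coefficient serves at most
`2K+1` of them. Hence at least about `K/4` coefficients are even, where `K` is about `√(24X)/6`. -/

lemma summable_of_X_pow_dvd {ι : Type*} {f : ι → ℤ⟦X⟧} (w : ι → ℕ)
    (hw : ∀ n, {i | w i ≤ n}.Finite) (h : ∀ i, X ^ w i ∣ f i) : Summable f := by
  rw [WithPiTopology.summable_iff_summable_coeff]
  intro n
  refine summable_of_hasFiniteSupport ((hw n).subset fun i hi ↦ ?_)
  by_contra hlt
  exact hi (X_pow_dvd_iff.1 (h i) n (not_le.1 hlt))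

lemma summable_nat_of_X_pow_dvd {f : ℕ → ℤ⟦X⟧} (h : ∀ i, X ^ i ∣ f i) : Summable f :=
  summable_of_X_pow_dvd id (fun n ↦ Set.finite_Iic n) h

lemma eq_of_forall_X_pow_dvd_sub {f g : ℤ⟦X⟧} (h : ∀ n, X ^ n ∣ f - g) : f = g := by
  ext n
  have := X_pow_dvd_iff.1 (h (n + 1)) n n.lt_succ_self
  rwa [map_sub, sub_eq_zero] at this

/-- The `q`-Pochhammer symbol `(q; q)ₙ`. -/
noncomputable def qPoch (n : ℕ) : ℤ⟦X⟧ := ∏ i ∈ range n, (1 - X ^ (i + 1))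

/-- The geometric series `1 / (1 - q ^ k)`, for `k > 0`. -/
noncomputable def geom (k : ℕ) : ℤ⟦X⟧ := ∑' i, (X ^ k) ^ i

/-- The inverse of `qPoch n`. -/
noncomputable def qInv (n : ℕ) : ℤ⟦X⟧ := ∏ i ∈ range n, geom (i + 1)

lemma hasSum_geom {k : ℕ} (hk : 0 < k) : HasSum (fun i ↦ ((X : ℤ⟦X⟧) ^ k) ^ i) (geom k) :=
  (WithPiTopology.summable_pow_of_constantCoeff_eq_zero (by simp [hk.ne'])).hasSum

lemma geom_mul {k : ℕ} (hk : 0 < k) : geom k * (1 - X ^ k) = 1 :=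
  WithPiTopology.tsum_pow_mul_one_sub_of_constantCoeff_eq_zero (by simp [hk.ne'])

lemma qInv_mul_qPoch (n : ℕ) : qInv n * qPoch n = 1 := by
  rw [qInv, qPoch, ← prod_mul_distrib]
  exact prod_eq_one fun i _ ↦ geom_mul i.succ_pos

@[simp] lemma qInv_zero : qInv 0 = 1 := by simp [qInv]

lemma qInv_succ_mul (n : ℕ) : qInv (n + 1) * (1 - X ^ (n + 1)) = qInv n := by
  rw [qInv, prod_range_succ, mul_assoc, geom_mul n.succ_pos, mul_one, qInv]

/-- The Euler product `(q; q)_∞`. -/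
noncomputable abbrev euler : ℤ⟦X⟧ := pentagonalSeries ℤ

lemma X_pow_dvd_prod_sub_one {s : Finset ℕ} {n : ℕ} (hs : ∀ i ∈ s, n ≤ i) :
    (X : ℤ⟦X⟧) ^ (n + 1) ∣ ∏ i ∈ s, (1 - X ^ (i + 1)) - 1 := by
  induction s using Finset.induction_on with
  | empty => simp
  | insert a s ha ih =>
    rw [prod_insert ha]
    have h1 : (X : ℤ⟦X⟧) ^ (n + 1) ∣ X ^ (a + 1) := pow_dvd_pow _ (by
      have := hs a (mem_insert_self a s); omega)
    have h2 := ih fun i hi ↦ hs i (mem_insert_of_mem hi)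
    have : (1 - X ^ (a + 1) : ℤ⟦X⟧) * ∏ i ∈ s, (1 - X ^ (i + 1)) - 1 =
      (∏ i ∈ s, (1 - X ^ (i + 1)) - 1) - X ^ (a + 1) * ∏ i ∈ s, (1 - X ^ (i + 1)) := by ring
    rw [this]
    exact dvd_sub h2 (h1.mul_right _)

lemma X_pow_dvd_euler_sub_qPoch (n : ℕ) : X ^ (n + 1) ∣ euler - qPoch n := by
  rw [X_pow_dvd_iff]
  intro d hd
  obtain ⟨s, hs⟩ := Filter.eventually_atTop.1 (coeff_prod_one_sub_X_pow_eventually_eq ℤ d)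
  have h := hs (s ∪ range n) subset_union_left
  rw [map_sub, ← h, ← map_sub]
  have hsub : range n ⊆ s ∪ range n := subset_union_right
  rw [← prod_sdiff hsub, qPoch, ← sub_one_mul]
  refine X_pow_dvd_iff.1 (Dvd.dvd.mul_right (X_pow_dvd_prod_sub_one fun i hi ↦ ?_) _) d hd
  simpa using (mem_sdiff.1 hi).2

lemma X_pow_dvd_qInv_mul_euler_sub_one (n : ℕ) : X ^ (n + 1) ∣ qInv n * euler - 1 := by
  have : qInv n * euler - 1 = qInv n * (euler - qPoch n) := by
    rw [mul_sub, qInv_mul_qPoch]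
  rw [this]
  exact (X_pow_dvd_euler_sub_qPoch n).mul_left _

/-- The sum `∑ₛ q ^ (s² + a s) / ((q)ₛ (q)ₛ₊ₐ)`. -/
noncomputable def durfee (a : ℕ) : ℤ⟦X⟧ := ∑' s, X ^ (s ^ 2 + a * s) * (qInv s * qInv (s + a))

lemma le_sq_add (s a : ℕ) : s ≤ s ^ 2 + a := (Nat.le_self_pow two_ne_zero s).trans le_self_add

lemma hasSum_durfee (a : ℕ) :
    HasSum (fun s ↦ X ^ (s ^ 2 + a * s) * (qInv s * qInv (s + a))) (durfee a) :=
  (summable_nat_of_X_pow_dvd fun _ ↦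
    Dvd.dvd.mul_right (pow_dvd_pow _ (le_sq_add _ _)) _).hasSum

/-- Both sides equal `∑ q^(s²+as) (1 - q^s - q^(s+a+1)) / ((q)_s (q)_(s+a+1))`, up to sending
`q^(s²+as)` with factor `1 - q^s` to the index `s - 1`. -/
lemma durfee_sub_durfee_succ (a : ℕ) :
    durfee a - durfee (a + 1) = X ^ (a + 1) * (durfee (a + 2) - durfee (a + 1)) := by
  have h1 : HasSum (fun s ↦ X ^ (s ^ 2 + a * s) * (1 - X ^ s) * (qInv s * qInv (s + a + 1)))
      (X ^ (a + 1) * durfee (a + 2)) := by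
    have := ((hasSum_durfee (a + 2)).mul_left (X ^ (a + 1)))
    rw [← hasSum_nat_add_iff' 1]
    simp only [range_one, sum_singleton, pow_zero, sub_self, mul_zero, zero_mul, sub_zero]
    refine this.congr_fun fun s ↦ ?_
    rw [← qInv_succ_mul s, show s + 1 + a + 1 = s + (a + 2) by ring]
    ring
  have h2 := ((hasSum_durfee (a + 1)).mul_left (X ^ (a + 1)))
  rw [mul_sub]
  refine ((hasSum_durfee a).sub (hasSum_durfee (a + 1))).unique ?_
  refine (h1.sub h2).congr_fun fun s ↦ ?_
  rw [← add_assoc, ← qInv_succ_mul (s + a)]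
  ring

/-- Iterating the recurrence gains a factor `q^(a+1)` each time, so the difference is divisible by
every power of `q`. -/
lemma durfee_succ (a : ℕ) : durfee (a + 1) = durfee a := by
  suffices h : ∀ n a, X ^ n ∣ durfee a - durfee (a + 1) from
    (eq_of_forall_X_pow_dvd_sub fun n ↦ h n a).symm
  intro n
  induction n with
  | zero => simp
  | succ n ih =>
    intro a
    rw [durfee_sub_durfee_succ, pow_succ']
    refine mul_dvd_mul (dvd_pow_self _ (by omega)) ?_
    rw [dvd_sub_comm]
    exact ih _

lemma X_pow_dvd_tsum {f : ℕ → ℤ⟦X⟧} {n : ℕ} (h : ∀ i, X ^ n ∣ f i) (hf : Summable f) :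
    X ^ n ∣ ∑' i, f i := by
  rw [X_pow_dvd_iff]
  intro d hd
  rw [hf.map_tsum _ (WithPiTopology.continuous_coeff ℤ d)]
  simp [fun i ↦ X_pow_dvd_iff.1 (h i) d hd]

/-- The Durfee rectangle identity. The sum does not depend on `a`, and as `a` grows only its term `s
= 0`, namely `1/(q)_a`, survives. -/
lemma durfee_mul_euler (a : ℕ) : durfee a * euler = 1 := by
  have h0 : ∀ b, durfee b = durfee 0 := fun b ↦ by
    induction b with
    | zero => rfl
    | succ b ih => rw [durfee_succ, ih]
  rw [h0]
  refine eq_of_forall_X_pow_dvd_sub fun n ↦ ?_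
  have h1 : X ^ n ∣ durfee n - qInv n := by
    rw [durfee, (hasSum_durfee n).summable.tsum_eq_zero_add]
    simp only [ne_eq, OfNat.ofNat_ne_zero, not_false_eq_true, zero_pow, mul_zero, add_zero,
      pow_zero, one_mul, zero_add, qInv_zero, add_sub_cancel_left]
    refine X_pow_dvd_tsum (fun i ↦ Dvd.dvd.mul_right (pow_dvd_pow _ (by nlinarith)) _)
      ((summable_nat_add_iff 1).2 (hasSum_durfee n).summable)
  have h2 := (pow_dvd_pow X n.le_succ).trans (X_pow_dvd_qInv_mul_euler_sub_one n)
  rw [← h0 n]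
  have : durfee n * euler - 1 = (durfee n - qInv n) * euler + (qInv n * euler - 1) := by ring
  rw [this]
  exact dvd_add (h1.mul_right _) h2

/-- Summation of a Bailey pair relative to `q ^ e`, with trivial parameters. -/
theorem tsum_bailey (e : ℕ) (α : ℕ → ℤ⟦X⟧) :
    (∑' m, X ^ (m ^ 2 + e * m) *
      ∑ r ∈ range (m + 1), α r * (qInv (m - r) * qInv (m + r + e))) * euler =
    ∑' r, X ^ (r ^ 2 + e * r) * α r := by
  set F : ℕ × ℕ → ℤ⟦X⟧ := fun p ↦ X ^ (p.1 ^ 2 + e * p.1) * α p.1 *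
    (X ^ (p.2 ^ 2 + (2 * p.1 + e) * p.2) * (qInv p.2 * qInv (p.2 + (2 * p.1 + e)))) with hF
  have hsum : Summable F := by
    refine summable_of_X_pow_dvd (fun p ↦ p.1 + p.2) (fun n ↦ ?_) fun p ↦ ?_
    · refine ((Set.finite_Iic n).prod (Set.finite_Iic n)).subset fun p hp ↦ ?_
      simp only [Set.mem_ofPred_eq, Set.mem_prod, Set.mem_Iic] at hp ⊢
      omega
    · rw [pow_add]
      exact mul_dvd_mul (Dvd.dvd.mul_right (pow_dvd_pow _ (le_sq_add _ _)) _)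
        (Dvd.dvd.mul_right (pow_dvd_pow _ (le_sq_add _ _)) _)
  have hanti : HasSum (fun m ↦ X ^ (m ^ 2 + e * m) *
      ∑ r ∈ range (m + 1), α r * (qInv (m - r) * qInv (m + r + e))) (∑' p, F p) := by
    have h := (Finset.HasAntidiagonal.sigmaAntidiagonalEquivProd (A := ℕ)).hasSum_iff.2 hsum.hasSum
    refine (h.sigma fun m ↦ hasSum_fintype _).congr_fun fun m ↦ ?_
    simp only [Function.comp_apply, HasAntidiagonal.sigmaAntidiagonalEquivProd_apply]
    rw [Finset.sum_coe_sort (antidiagonal m) F, Nat.sum_antidiagonal_eq_sum_range_succ_mk, mul_sum]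
    refine sum_congr rfl fun r hr ↦ ?_
    obtain ⟨s, rfl⟩ := Nat.exists_eq_add_of_le (mem_range_succ_iff.1 hr)
    simp only [hF, add_tsub_cancel_left]
    rw [show r + s + r + e = s + (2 * r + e) by ring]
    ring
  -- With `m = r + s` the sum over `s` at fixed `r` is a Durfee sum with parameter `2r + e`, which
  -- `euler` cancels.
  have hprod : HasSum (fun r ↦ X ^ (r ^ 2 + e * r) * α r * durfee (2 * r + e)) (∑' p, F p) :=
    hsum.hasSum.prod_fiberwise fun r ↦
      ((hasSum_durfee (2 * r + e)).mul_left (X ^ (r ^ 2 + e * r) * α r)).congr_fun fun s ↦ rfl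
  have hmul := (hprod.mul_right euler).congr_fun (g := fun r ↦ X ^ (r ^ 2 + e * r) * α r)
    fun r ↦ by rw [mul_assoc _ (durfee _), durfee_mul_euler, mul_one]
  exact (congrArg (· * euler) hanti.tsum_eq).trans hmul.tsum_eq.symm

end QSeries

section BaileyPairs

open PowerSeries Finset
open scoped PowerSeries.WithPiTopology

/-! ### Bailey pairs -/

/-- The kernel `1 / ((q)ₘ₋ᵣ (q)ₘ₊ᵣ₊ₑ)` of a Bailey pair relative to `q ^ e`. -/
noncomputable def baileyKernel (e m r : ℕ) : ℤ⟦X⟧ :=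
  if r ≤ m then qInv (m - r) * qInv (m + r + e) else 0

lemma baileyKernel_of_lt {e m r : ℕ} (h : m < r) : baileyKernel e m r = 0 :=
  if_neg (not_le.2 h)

lemma baileyKernel_of_le {e m r : ℕ} (h : r ≤ m) :
    baileyKernel e m r = qInv (m - r) * qInv (m + r + e) := if_pos h

lemma baileyKernel_zero (e m : ℕ) : baileyKernel e m 0 = qInv m * qInv (m + e) := by
  simp [baileyKernel]

/-- The two kernels on the right are `1 - q^(m+j+1)` and `1 - q^(m-j)` times the one on the left,
and `1 - q^(2m+1)` is the first factor plus `q^(m+j+1)` times the second. -/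
lemma baileyKernel_one (m j : ℕ) : (1 - X ^ (2 * m + 1)) * baileyKernel 1 m j =
    baileyKernel 0 m j + X ^ (m + j + 1) * baileyKernel 0 m (j + 1) := by
  rcases lt_trichotomy m j with h | rfl | h
  · simp [baileyKernel_of_lt h, baileyKernel_of_lt (h.trans j.lt_succ_self)]
  · rw [baileyKernel_of_lt m.lt_succ_self, baileyKernel_of_le le_rfl, baileyKernel_of_le le_rfl,
      add_zero, ← qInv_succ_mul (m + m)]
    ring
  · obtain ⟨d, rfl⟩ := Nat.exists_eq_add_of_lt h
    rw [baileyKernel_of_le (by omega), baileyKernel_of_le (by omega), baileyKernel_of_le (by omega),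
      show j + d + 1 - j = d + 1 by omega, show j + d + 1 - (j + 1) = d by omega, add_zero,
      add_zero, ← qInv_succ_mul d, ← qInv_succ_mul (j + d + 1 + j), ← add_assoc (j + d + 1) j 1]
    ring

/-- The same splitting with the two factors exchanged. The power `X ^ j` clears `q^(m-j)`, so that
`m < j` needs no separate form. -/
lemma baileyKernel_one' (m j : ℕ) : X ^ j * ((1 - X ^ (2 * m + 1)) * baileyKernel 1 m j) =
    X ^ j * baileyKernel 0 m (j + 1) + X ^ m * baileyKernel 0 m j := by
  rcases lt_trichotomy m j with h | rfl | h
  · simp [baileyKernel_of_lt h, baileyKernel_of_lt (h.trans j.lt_succ_self)]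
  · rw [baileyKernel_of_lt m.lt_succ_self, baileyKernel_of_le le_rfl, baileyKernel_of_le le_rfl,
      add_zero, ← qInv_succ_mul (m + m)]
    ring
  · obtain ⟨d, rfl⟩ := Nat.exists_eq_add_of_lt h
    rw [baileyKernel_of_le (by omega), baileyKernel_of_le (by omega), baileyKernel_of_le (by omega),
      show j + d + 1 - j = d + 1 by omega, show j + d + 1 - (j + 1) = d by omega, add_zero,
      add_zero, ← qInv_succ_mul d, ← qInv_succ_mul (j + d + 1 + j), ← add_assoc (j + d + 1) j 1]
    ring

/-- The analogous splitting of `1 - q^(2n+2)`, with the roles of `e = 0` and `e = 1` exchanged. -/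
lemma baileyKernel_zero_succ (n i : ℕ) :
    (1 - X ^ (2 * n + 2)) * baileyKernel 0 (n + 1) (i + 1) =
      baileyKernel 1 n i + X ^ (n + i + 2) * baileyKernel 1 n (i + 1) := by
  rcases lt_trichotomy n i with h | rfl | h
  · simp [baileyKernel_of_lt h, baileyKernel_of_lt (h.trans i.lt_succ_self),
      baileyKernel_of_lt (Nat.succ_lt_succ h)]
  · rw [baileyKernel_of_lt n.lt_succ_self, baileyKernel_of_le le_rfl, baileyKernel_of_le le_rfl,
      show n + 1 + (n + 1) + 0 = n + n + 1 + 1 by ring, ← qInv_succ_mul (n + n + 1)]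
    simp only [tsub_self]
    ring
  · obtain ⟨d, rfl⟩ := Nat.exists_eq_add_of_lt h
    rw [baileyKernel_of_le (by omega), baileyKernel_of_le (by omega), baileyKernel_of_le (by omega),
      show i + d + 1 + 1 - (i + 1) = d + 1 by omega, show i + d + 1 - i = d + 1 by omega,
      show i + d + 1 - (i + 1) = d by omega,
      show i + d + 1 + 1 + (i + 1) + 0 = (i + d + 1 + i + 1) + 1 by ring,
      show i + d + 1 + (i + 1) + 1 = (i + d + 1 + i + 1) + 1 by ring,
      ← qInv_succ_mul d, ← qInv_succ_mul (i + d + 1 + i + 1)]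
    ring

lemma baileyKernel_zero_succ' (n i : ℕ) :
    X ^ (i + 1) * ((1 - X ^ (2 * n + 2)) * baileyKernel 0 (n + 1) (i + 1)) =
      X ^ (i + 1) * baileyKernel 1 n (i + 1) + X ^ (n + 1) * baileyKernel 1 n i := by
  rcases lt_trichotomy n i with h | rfl | h
  · simp [baileyKernel_of_lt h, baileyKernel_of_lt (h.trans i.lt_succ_self),
      baileyKernel_of_lt (Nat.succ_lt_succ h)]
  · rw [baileyKernel_of_lt n.lt_succ_self, baileyKernel_of_le le_rfl, baileyKernel_of_le le_rfl,
      show n + 1 + (n + 1) + 0 = n + n + 1 + 1 by ring, ← qInv_succ_mul (n + n + 1)]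
    simp only [tsub_self]
    ring
  · obtain ⟨d, rfl⟩ := Nat.exists_eq_add_of_lt h
    rw [baileyKernel_of_le (by omega), baileyKernel_of_le (by omega), baileyKernel_of_le (by omega),
      show i + d + 1 + 1 - (i + 1) = d + 1 by omega, show i + d + 1 - i = d + 1 by omega,
      show i + d + 1 - (i + 1) = d by omega,
      show i + d + 1 + 1 + (i + 1) + 0 = (i + d + 1 + i + 1) + 1 by ring,
      show i + d + 1 + (i + 1) + 1 = (i + d + 1 + i + 1) + 1 by ring,
      ← qInv_succ_mul d, ← qInv_succ_mul (i + d + 1 + i + 1)]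
    ring

lemma sum_mul_baileyKernel (e : ℕ) (α : ℕ → ℤ⟦X⟧) {m N : ℕ} (h : m < N) :
    ∑ r ∈ range (m + 1), α r * (qInv (m - r) * qInv (m + r + e)) =
      ∑ r ∈ range N, α r * baileyKernel e m r := by
  rw [← sum_subset (range_subset_range.2 (Nat.succ_le_of_lt h)) fun r _ hr ↦ by
    rw [baileyKernel_of_lt (by simpa using hr), mul_zero]]
  exact sum_congr rfl fun r hr ↦ by rw [baileyKernel_of_le (mem_range_succ_iff.1 hr)]

lemma eq_mul_geom_of_one_sub_mul {k : ℕ} (hk : 0 < k) {a b : ℤ⟦X⟧} (h : (1 - X ^ k) * a = b) :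
    a = b * geom k := by
  rw [← h, mul_comm, ← mul_assoc, geom_mul hk, one_mul]

/-- The numerators `(-1)^r q ^ (2 ⌈r/2⌉²)`. -/
noncomputable def alphaOne (r : ℕ) : ℤ⟦X⟧ := (-1) ^ r * X ^ (2 * ((r + 1) / 2) ^ 2)

lemma sum_alphaOne_mul_baileyKernel (m K : ℕ) : (1 - X ^ (2 * m + 1)) *
    ∑ r ∈ range (2 * K + 1), alphaOne r * baileyKernel 1 m r =
      baileyKernel 0 m 0 + X ^ (m + 1 + (2 * K ^ 2 + 2 * K)) * baileyKernel 0 m (2 * K + 1) := by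
  induction K with
  | zero => simpa [alphaOne] using baileyKernel_one m 0
  | succ K ih =>
    rw [show 2 * (K + 1) + 1 = 2 * K + 1 + 1 + 1 by ring, sum_range_succ, sum_range_succ, add_assoc,
      mul_add, ih]
    have h1 := baileyKernel_one m (2 * K + 1 + 1)
    have h2 := baileyKernel_one' m (2 * K + 1)
    have e1 : alphaOne (2 * K + 1) = - X ^ (2 * (K + 1) ^ 2) := by
      rw [alphaOne, show (2 * K + 1 + 1) / 2 = K + 1 by omega, Odd.neg_one_pow ⟨K, rfl⟩]
      ring
    have e2 : alphaOne (2 * K + 1 + 1) = X ^ (2 * (K + 1) ^ 2) := by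
      rw [alphaOne, show (2 * K + 1 + 1 + 1) / 2 = K + 1 by omega,
        Even.neg_one_pow ⟨K + 1, by ring⟩, one_mul]
    rw [e1, e2]
    -- The numerators at `2K+1` and `2K+2` are opposite, so the two splittings cancel the kernel at
    -- `2K+2`. What remains at `2K+1` cancels the old boundary term, and the sum telescopes.
    linear_combination X ^ (2 * (K + 1) ^ 2) * h1 - X ^ (2 * K ^ 2 + 2 * K + 1) * h2

theorem bailey_alphaOne (m : ℕ) :
    ∑ r ∈ range (m + 1), alphaOne r * (qInv (m - r) * qInv (m + r + 1)) =
      qInv m ^ 2 * geom (2 * m + 1) := by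
  -- Summing up to `2m` adds only zero kernels, and puts the boundary term of the telescoped sum at
  -- `2m+1 > m`, where it vanishes.
  rw [sum_mul_baileyKernel 1 alphaOne (N := 2 * m + 1) (by omega)]
  refine eq_mul_geom_of_one_sub_mul (by omega) ?_
  rw [sum_alphaOne_mul_baileyKernel, baileyKernel_of_lt (r := 2 * m + 1) (by omega),
    baileyKernel_zero]
  ring_nf

/-- The numerators `0, 1` and then `(-1)^(r+1) q ^ (2 ⌊r/2⌋² + 2 ⌊r/2⌋)`. -/
noncomputable def alphaTwo (r : ℕ) : ℤ⟦X⟧ :=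
  if r = 0 then 0 else (-1) ^ (r + 1) * X ^ (2 * (r / 2) ^ 2 + 2 * (r / 2))

lemma sum_alphaTwo_mul_baileyKernel (m K : ℕ) : (1 - X ^ (2 * m + 1)) *
    ∑ r ∈ range (2 * K + 2), alphaTwo r * baileyKernel 1 m r =
      baileyKernel 0 m 1 +
        X ^ (m + 2 + (2 * K ^ 2 + 4 * K)) * baileyKernel 0 m (2 * K + 2) := by
  induction K with
  | zero =>
    have := baileyKernel_one m 1
    simpa [alphaTwo, sum_range_succ] using this
  | succ K ih =>
    rw [show 2 * (K + 1) + 2 = 2 * K + 2 + 1 + 1 by ring, sum_range_succ, sum_range_succ, add_assoc,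
      mul_add, ih]
    have h1 := baileyKernel_one m (2 * K + 2 + 1)
    have h2 := baileyKernel_one' m (2 * K + 2)
    have e1 : alphaTwo (2 * K + 2) = - X ^ (2 * (K + 1) ^ 2 + 2 * (K + 1)) := by
      rw [alphaTwo, if_neg (by omega), show (2 * K + 2) / 2 = K + 1 by omega,
        Odd.neg_one_pow ⟨K + 1, by ring⟩]
      ring
    have e2 : alphaTwo (2 * K + 2 + 1) = X ^ (2 * (K + 1) ^ 2 + 2 * (K + 1)) := by
      rw [alphaTwo, if_neg (by omega), show (2 * K + 2 + 1) / 2 = K + 1 by omega,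
        Even.neg_one_pow ⟨K + 2, by ring⟩, one_mul]
    rw [e1, e2]
    linear_combination X ^ (2 * (K + 1) ^ 2 + 2 * (K + 1)) * h1 -
      X ^ (2 * K ^ 2 + 4 * K + 2) * h2

theorem bailey_alphaTwo (m : ℕ) :
    ∑ r ∈ range (m + 1), alphaTwo r * (qInv (m - r) * qInv (m + r + 1)) =
      qInv m * (1 - X ^ m) * qInv (m + 1) * geom (2 * m + 1) := by
  rw [sum_mul_baileyKernel 1 alphaTwo (N := 2 * m + 2) (by omega)]
  refine eq_mul_geom_of_one_sub_mul (by omega) ?_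
  rw [sum_alphaTwo_mul_baileyKernel, baileyKernel_of_lt (r := 2 * m + 2) (by omega), mul_zero,
    add_zero]
  cases m with
  | zero => simp [baileyKernel_of_lt]
  | succ n => rw [baileyKernel_of_le (by omega), qInv_succ_mul, Nat.add_sub_cancel, add_zero]

/-- The numerators `0, 1` and then `(-1)^(r+1) q ^ (2 ⌊r/2⌋² + ⌊r/2⌋)`. -/
noncomputable def alphaEven (r : ℕ) : ℤ⟦X⟧ :=
  if r = 0 then 0 else (-1) ^ (r + 1) * X ^ (2 * (r / 2) ^ 2 + r / 2)

lemma sum_alphaEven_mul_baileyKernel (n K : ℕ) : (1 - X ^ (2 * n + 2)) *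
    ∑ r ∈ range (2 * K + 2), alphaEven r * baileyKernel 0 (n + 1) r =
      baileyKernel 1 n 0 +
        X ^ (n + 2 + (2 * K ^ 2 + 3 * K)) * baileyKernel 1 n (2 * K + 1) := by
  induction K with
  | zero =>
    have := baileyKernel_zero_succ n 0
    simpa [alphaEven, sum_range_succ] using this
  | succ K ih =>
    rw [show 2 * (K + 1) + 2 = 2 * K + 2 + 1 + 1 by ring, sum_range_succ, sum_range_succ, add_assoc,
      mul_add, ih]
    have h1 := baileyKernel_zero_succ n (2 * K + 2)
    have h2 := baileyKernel_zero_succ' n (2 * K + 1)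
    have e1 : alphaEven (2 * K + 2) = - X ^ (2 * (K + 1) ^ 2 + (K + 1)) := by
      rw [alphaEven, if_neg (by omega), show (2 * K + 2) / 2 = K + 1 by omega,
        Odd.neg_one_pow ⟨K + 1, by ring⟩]
      ring
    have e2 : alphaEven (2 * K + 2 + 1) = X ^ (2 * (K + 1) ^ 2 + (K + 1)) := by
      rw [alphaEven, if_neg (by omega), show (2 * K + 2 + 1) / 2 = K + 1 by omega,
        Even.neg_one_pow ⟨K + 2, by ring⟩, one_mul]
    rw [e1, e2]
    linear_combination X ^ (2 * (K + 1) ^ 2 + (K + 1)) * h1 -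
      X ^ (2 * K ^ 2 + 3 * K + 1) * h2

theorem bailey_alphaEven (m : ℕ) :
    ∑ r ∈ range (m + 1), alphaEven r * (qInv (m - r) * qInv (m + r + 0)) =
      qInv m ^ 2 * (1 - X ^ m) * geom (2 * m) := by
  cases m with
  -- Here `geom 0` is a divergent sum, made harmless by the factor `1 - X ^ 0 = 0`.
  | zero => simp [alphaEven]
  | succ n =>
    rw [sum_mul_baileyKernel 0 alphaEven (N := 2 * (n + 1) + 2) (by omega)]
    refine eq_mul_geom_of_one_sub_mul (by omega) ?_
    have := sum_alphaEven_mul_baileyKernel n (n + 1)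
    rw [show 2 * n + 2 = 2 * (n + 1) by ring] at this
    rw [this, baileyKernel_of_lt (r := 2 * (n + 1) + 1) (by omega), baileyKernel_zero,
      ← qInv_succ_mul n]
    ring

end BaileyPairs

section GeneratingFunctions

open PowerSeries Finset
open scoped PowerSeries.WithPiTopology

/-! ### Generating functions of concave compositions -/

lemma finite_nodup_sum_le (n : ℕ) : {l : List ℕ | l.Nodup ∧ l.sum ≤ n}.Finite := by
  refine (Set.finite_range fun l : {l : List (Fin (n + 1)) // l.Nodup} ↦
    l.1.map Fin.val).subset ?_
  rintro l ⟨hl, hs⟩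
  have hlt : ∀ x ∈ l, x < n + 1 := fun x hx ↦
    Nat.lt_succ_of_le ((List.single_le_sum (by simp) x hx).trans hs)
  lift l to List (Fin (n + 1)) using hlt
  exact ⟨⟨l, hl.of_map _⟩, rfl⟩

lemma coeff_of_hasSum_X_pow {ι : Type*} {w : ι → ℕ} {G : ℤ⟦X⟧}
    (h : HasSum (fun i ↦ (X : ℤ⟦X⟧) ^ w i) G) (n : ℕ) :
    coeff n G = ({i | w i = n}.ncard : ℤ) := by
  have h1 : HasSum (fun i ↦ if n = w i then (1 : ℤ) else 0) (coeff n G) := by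
    simpa only [coeff_X_pow] using (WithPiTopology.hasSum_iff_hasSum_coeff ℤ).1 h n
  have hfin : {i | w i = n}.Finite := h1.summable.hasFiniteSupport_of_discreteTopology.subset
    fun i hi ↦ by simp [show w i = n from hi]
  rw [Set.ncard_eq_toFinset_card _ hfin]
  refine h1.unique ?_
  have : HasSum (fun i ↦ if n = w i then (1 : ℤ) else 0) _ :=
    hasSum_sum_of_ne_finset_zero (s := hfin.toFinset) fun i hi ↦ if_neg fun e ↦ hi (by simp [e])
  rwa [sum_congr rfl fun i hi ↦ if_pos ((hfin.mem_toFinset.1 hi).symm), sum_const, nsmul_eq_mul,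
    mul_one] at this

/-- Strictly increasing lists of length `m` with all entries at least `c`. -/
abbrev IncList (m c : ℕ) : Type :=
  {l : List ℕ // l.length = m ∧ l.Pairwise (· < ·) ∧ ∀ x ∈ l, c ≤ x}

lemma pairwise_cons_of_mem {m c a : ℕ} (l : IncList m c) (h : a < c) :
    (a :: l.1).Pairwise (· < ·) :=
  List.pairwise_cons.2 ⟨fun x hx ↦ h.trans_le (l.2.2.2 x hx), l.2.2.1⟩

/-- Prepending a least entry to an increasing list. -/
def IncList.cons (m c : ℕ) (p : Σ d : ℕ, IncList m (c + d + 1)) : IncList (m + 1) c :=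
  ⟨(c + p.1) :: p.2.1, by simp [p.2.2.1], pairwise_cons_of_mem p.2 (Nat.lt_succ_self _), by
    have := p.2.2.2.2
    simp only [List.mem_cons, forall_eq_or_imp, Nat.le_add_right, true_and]
    intro x hx
    have := this x hx
    omega⟩

lemma IncList.cons_bijective (m c : ℕ) : Function.Bijective (IncList.cons m c) := by
  constructor
  · rintro ⟨d, l, hl⟩ ⟨d', l', hl'⟩ h
    simp only [IncList.cons, Subtype.mk.injEq, List.cons.injEq, Nat.add_left_cancel_iff] at h
    obtain ⟨rfl, rfl⟩ := h
    rfl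
  · rintro ⟨_ | ⟨a, l⟩, h1, h2, h3⟩
    · simp at h1
    · have ha := h3 a (by simp)
      refine ⟨⟨a - c, l, by simpa using h1, (List.pairwise_cons.1 h2).2, fun x hx ↦ ?_⟩, ?_⟩
      · have := (List.pairwise_cons.1 h2).1 x hx
        omega
      · simp [IncList.cons, Nat.add_sub_cancel' ha]

lemma summable_X_pow {ι : Type*} (w : ι → ℕ) (hw : ∀ n, {i | w i ≤ n}.Finite) :
    Summable fun i ↦ (X : ℤ⟦X⟧) ^ w i :=
  summable_of_X_pow_dvd w hw fun _ ↦ dvd_rfl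

lemma summable_incList (m c : ℕ) : Summable fun l : IncList m c ↦ (X : ℤ⟦X⟧) ^ l.1.sum :=
  summable_X_pow _ fun n ↦ Set.Finite.of_injOn (f := Subtype.val) (t := {l | l.Nodup ∧ l.sum ≤ n})
    (fun l hl ↦ ⟨l.2.2.1.imp fun h ↦ h.ne, hl⟩) Subtype.val_injective.injOn (finite_nodup_sum_le n)

lemma summable_incList_prod (m c m' c' : ℕ) : Summable fun p : IncList m c × IncList m' c' ↦
    (X : ℤ⟦X⟧) ^ p.1.1.sum * X ^ p.2.1.sum := by
  simp only [← pow_add]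
  refine summable_X_pow _ fun n ↦ Set.Finite.of_injOn (f := Prod.map Subtype.val Subtype.val)
    (t := {l : List ℕ | l.Nodup ∧ l.sum ≤ n} ×ˢ {l : List ℕ | l.Nodup ∧ l.sum ≤ n})
    (fun p hp ↦ ?_) (Subtype.val_injective.prodMap Subtype.val_injective).injOn
    ((finite_nodup_sum_le n).prod (finite_nodup_sum_le n))
  exact ⟨⟨p.1.2.2.1.imp fun h ↦ h.ne, (Nat.le_add_right _ _).trans hp⟩,
    ⟨p.2.2.2.1.imp fun h ↦ h.ne, (Nat.le_add_left _ _).trans hp⟩⟩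

lemma qInv_succ (m : ℕ) : qInv (m + 1) = qInv m * geom (m + 1) := prod_range_succ _ _

/-- Removing the least entry `c + d` leaves a list with entries at least `c + d + 1`; the sum over
`d` is geometric with ratio `q^(m+1)`. -/
lemma hasSum_incList (m c : ℕ) : HasSum (fun l : IncList m c ↦ (X : ℤ⟦X⟧) ^ l.1.sum)
    (X ^ (c * m + m.choose 2) * qInv m) := by
  induction m generalizing c with
  | zero =>
    have : Unique (IncList 0 c) :=
      ⟨⟨⟨[], by simp⟩⟩, fun l ↦ Subtype.ext (List.length_eq_zero_iff.1 l.2.1)⟩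
    convert hasSum_unique _
    rw [List.length_eq_zero_iff.1 (default : IncList 0 c).2.1]
    simp
  | succ m ih =>
    rw [← (Equiv.ofBijective _ (IncList.cons_bijective m c)).hasSum_iff]
    have h1 := (hasSum_geom m.succ_pos).mul_left (X ^ (c + (c + 1) * m + m.choose 2) * qInv m)
    have e1 : X ^ (c + (c + 1) * m + m.choose 2) * qInv m * geom (m + 1) =
        X ^ (c * (m + 1) + (m + 1).choose 2) * qInv (m + 1) := by
      rw [qInv_succ, Nat.choose_succ_succ' m 1, Nat.choose_one_right]
      ring
    rw [e1] at h1
    refine h1.sigma_of_hasSum (fun d ↦ ?_) ?_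
    · refine HasSum.congr_fun (f := fun l : IncList m (c + d + 1) ↦ X ^ (c + d) * X ^ l.1.sum) ?_
        fun l ↦ ?_
      · convert (ih (c + d + 1)).mul_left (X ^ (c + d)) using 1
        rw [Nat.succ_eq_add_one]
        ring
      · simp [IncList.cons, pow_add]
    · exact (Equiv.ofBijective _ (IncList.cons_bijective m c)).summable_iff.2 (summable_incList _ _)

/-- A central part `c`, together with two increasing lists of the same length,
with entries at least `c + 1` and `c + e`. -/
abbrev Concave (e : ℕ) : Type := Σ m : ℕ, Σ c : ℕ, IncList m (c + 1) × IncList m (c + e)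

/-- The sum of the parts, the central one being counted `k` times. -/
def Concave.weight {e : ℕ} (k : ℕ) (t : Concave e) : ℕ :=
  k * t.2.1 + t.2.2.1.1.sum + t.2.2.2.1.sum

lemma Concave.toLists_injective (e : ℕ) :
    Function.Injective fun t : Concave e ↦ (t.2.1 :: t.2.2.1.1, t.2.2.2.1) := by
  rintro ⟨m, c, ⟨a, ha⟩, ⟨b, hb⟩⟩ ⟨m', c', ⟨a', ha'⟩, ⟨b', hb'⟩⟩ h
  simp only [Prod.mk.injEq, List.cons.injEq] at h
  obtain ⟨⟨rfl, rfl⟩, rfl⟩ := h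
  obtain rfl : m = m' := ha.1.symm.trans ha'.1
  rfl

lemma Concave.summable (e : ℕ) {k : ℕ} (hk : 0 < k) :
    Summable fun t : Concave e ↦ (X : ℤ⟦X⟧) ^ t.weight k := by
  refine summable_X_pow _ fun n ↦ Set.Finite.of_injOn
    (t := {l : List ℕ | l.Nodup ∧ l.sum ≤ n} ×ˢ {l : List ℕ | l.Nodup ∧ l.sum ≤ n}) ?_
    (Concave.toLists_injective e).injOn ((finite_nodup_sum_le n).prod (finite_nodup_sum_le n))
  rintro ⟨m, c, a, b⟩ h
  simp only [Concave.weight, Set.mem_ofPred_eq] at h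
  have := Nat.le_mul_of_pos_left c hk
  refine ⟨⟨(pairwise_cons_of_mem a c.lt_succ_self).imp fun h ↦ h.ne, ?_⟩,
    ⟨b.2.2.1.imp fun h ↦ h.ne, ?_⟩⟩
  · simp only [List.sum_cons]
    omega
  · show b.1.sum ≤ n
    omega

lemma two_mul_choose_two_add (m : ℕ) : 2 * m.choose 2 + m = m ^ 2 := by
  induction m with
  | zero => rfl
  | succ m ih =>
    rw [Nat.choose_succ_succ' m 1, Nat.choose_one_right]
    linarith

/-- The generating function of concave compositions. -/
noncomputable def concaveSeries (e k : ℕ) : ℤ⟦X⟧ :=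
  ∑' m, X ^ (m ^ 2 + e * m) * (qInv m ^ 2 * geom (2 * m + k))

lemma hasSum_concaveSeries (e k : ℕ) :
    HasSum (fun m ↦ X ^ (m ^ 2 + e * m) * (qInv m ^ 2 * geom (2 * m + k))) (concaveSeries e k) :=
  (summable_nat_of_X_pow_dvd fun _ ↦
    Dvd.dvd.mul_right (pow_dvd_pow _ (le_sq_add _ _)) _).hasSum

/-- For fixed `m`, raising the central part by one raises all `2m` other lower bounds too, so the
sum over `c` is geometric with ratio `q^(2m+k)`. -/
lemma hasSum_concave (e : ℕ) {k : ℕ} (hk : 0 < k) :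
    HasSum (fun t : Concave e ↦ (X : ℤ⟦X⟧) ^ t.weight k) (concaveSeries e k) := by
  refine (hasSum_concaveSeries e k).sigma_of_hasSum (fun m ↦ ?_) (Concave.summable e hk)
  have h1 := (hasSum_geom (k := 2 * m + k) (by omega)).mul_left (X ^ (m ^ 2 + e * m) * qInv m ^ 2)
  rw [mul_assoc] at h1
  refine h1.sigma_of_hasSum (fun c ↦ ?_) ((Concave.summable e hk).sigma_factor m)
  have h2 := ((hasSum_incList m (c + 1)).mul (hasSum_incList m (c + e))
    (summable_incList_prod _ _ _ _)).mul_left (X ^ (k * c))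
  have e2 : X ^ (k * c) * (X ^ ((c + 1) * m + m.choose 2) * qInv m *
      (X ^ ((c + e) * m + m.choose 2) * qInv m)) =
      X ^ (m ^ 2 + e * m) * qInv m ^ 2 * (X ^ (2 * m + k)) ^ c := by
    rw [← two_mul_choose_two_add]
    ring
  rw [e2] at h2
  refine h2.congr_fun fun t ↦ ?_
  rw [Concave.weight, pow_add, pow_add, mul_assoc]

/-- Here `k = 2` because the central value occurs in both halves. Increasing lists from the centre
outwards are the reversals of the given halves. -/
lemma ce_eq_coeff (n : ℕ) : ce n = coeff n (concaveSeries 1 2) := by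
  rw [coeff_of_hasSum_X_pow (hasSum_concave 1 two_pos), ce, Nat.cast_inj]
  have hinj : Function.Injective fun t : Concave 1 ↦
      ((t.2.1 :: t.2.2.1.1).reverse, (t.2.1 :: t.2.2.2.1).reverse) := fun t t' h ↦ by
    simp only [Prod.mk.injEq, List.reverse_inj, List.cons.injEq] at h
    exact Concave.toLists_injective 1 (by simp [h.1.1, h.1.2, h.2.2])
  rw [← Set.ncard_image_of_injective _ hinj]
  congr 1
  ext ⟨a, b⟩
  obtain ⟨a, rfl⟩ : ∃ a', a = List.reverse a' := ⟨a.reverse, by simp⟩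
  obtain ⟨b, rfl⟩ : ∃ a', b = List.reverse a' := ⟨b.reverse, by simp⟩
  constructor
  · rintro ⟨h0, h1, h2, h3, h4, h5⟩
    simp only [List.length_reverse, List.pairwise_reverse, List.getLast?_reverse, List.sum_reverse,
      ne_eq, List.reverse_eq_nil_iff, gt_iff_lt] at h0 h1 h2 h3 h4 h5
    match a, b, h0, h1, h2, h3, h4, h5 with
    | c :: a, c' :: b, h0, h1, h2, h3, h4, h5 =>
      obtain rfl : c = c' := by simpa using h4
      rw [List.pairwise_cons] at h2 h3
      refine ⟨⟨a.length, c, ⟨a, rfl, h2.2, h2.1⟩, ⟨b, by simpa using h1.symm, h3.2, h3.1⟩⟩, ?_, rfl⟩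
      simp only [Concave.weight, Set.mem_ofPred_eq, List.sum_cons] at h5 ⊢
      omega
  · rintro ⟨⟨m, c, a', b'⟩, h, he⟩
    simp only [Prod.mk.injEq, List.reverse_inj] at he
    obtain ⟨rfl, rfl⟩ := he
    simp only [Concave.weight, Set.mem_ofPred_eq] at h
    refine ⟨by simp, by simp [a'.2.1, b'.2.1], ?_, ?_, by simp, ?_⟩
    · simpa only [List.pairwise_reverse] using pairwise_cons_of_mem a' c.lt_succ_self
    · simpa only [List.pairwise_reverse] using pairwise_cons_of_mem b' c.lt_succ_self
    · simp only [List.sum_reverse, List.sum_cons]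
      omega

lemma coeff_concaveSeries_one (e n : ℕ) : (coeff n (concaveSeries e 1)) =
    ({p : List ℕ × List ℕ | p.1.length = p.2.length + 1 ∧
    p.1.Pairwise (· > ·) ∧ p.2.Pairwise (· > ·) ∧
    (∀ x ∈ p.1.getLast?, ∀ y ∈ p.2.getLast?, x + e ≤ y) ∧ p.1.sum + p.2.sum = n}.ncard : ℤ) := by
  rw [coeff_of_hasSum_X_pow (hasSum_concave e one_pos), Nat.cast_inj]
  have hinj : Function.Injective fun t : Concave e ↦
      ((t.2.1 :: t.2.2.1.1).reverse, t.2.2.2.1.reverse) := fun t t' h ↦ by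
    simp only [Prod.mk.injEq, List.reverse_inj] at h
    exact Concave.toLists_injective e (by simp [h.1, h.2])
  rw [← Set.ncard_image_of_injective _ hinj]
  congr 1
  ext ⟨a, b⟩
  obtain ⟨a, rfl⟩ : ∃ a', a = List.reverse a' := ⟨a.reverse, by simp⟩
  obtain ⟨b, rfl⟩ : ∃ a', b = List.reverse a' := ⟨b.reverse, by simp⟩
  constructor
  · rintro ⟨⟨m, c, a', b'⟩, h, he⟩
    simp only [Prod.mk.injEq, List.reverse_inj] at he
    obtain ⟨rfl, rfl⟩ := he
    simp only [Concave.weight, Set.mem_ofPred_eq] at h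
    refine ⟨by simp [a'.2.1, b'.2.1], ?_, ?_, ?_, ?_⟩
    · simpa only [List.pairwise_reverse] using pairwise_cons_of_mem a' c.lt_succ_self
    · simpa only [List.pairwise_reverse] using b'.2.2.1
    · intro x hx y hy
      simp only [List.getLast?_reverse, List.head?_cons, Option.mem_def, Option.some.injEq] at hx hy
      rw [← hx]
      exact b'.2.2.2 y (List.mem_of_mem_head? hy)
    · simp only [List.sum_reverse, List.sum_cons]
      omega
  · rintro ⟨h1, h2, h3, h4, h5⟩
    simp only [List.length_reverse, List.pairwise_reverse, List.getLast?_reverse, List.sum_reverse,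
      gt_iff_lt] at h1 h2 h3 h4 h5
    match a, h1, h2, h4, h5 with
    | c :: a, h1, h2, h4, h5 =>
      rw [List.pairwise_cons] at h2
      refine ⟨⟨a.length, c, ⟨a, rfl, h2.2, h2.1⟩, ⟨b, by simpa using h1.symm, h3, ?_⟩⟩, ?_, rfl⟩
      · match b, h3, h4 with
        | [], _, _ => simp
        | y :: b, h3, h4 =>
          have h := h4 c (by simp) y (by simp)
          intro x hx
          rcases List.mem_cons.1 hx with rfl | hx
          · exact h
          · exact h.trans ((List.pairwise_cons.1 h3).1 x hx).le
      · simp only [Concave.weight, Set.mem_ofPred_eq, List.sum_cons] at h5 ⊢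
        omega

lemma coOne_eq_coeff (n : ℕ) : coOne n = coeff n (concaveSeries 1 1) :=
  (coeff_concaveSeries_one 1 n).symm

lemma coTwo_eq_coeff (n : ℕ) : coTwo n = coeff n (concaveSeries 0 1) :=
  (coeff_concaveSeries_one 0 n).symm

end GeneratingFunctions

section ProductIdentities

open PowerSeries Finset
open scoped PowerSeries.WithPiTopology

/-! ### Products with the Euler function -/

theorem tsum_mul_euler_of_bailey (e : ℕ) {α β : ℕ → ℤ⟦X⟧}
    (h : ∀ m, ∑ r ∈ range (m + 1), α r * (qInv (m - r) * qInv (m + r + e)) = β m) :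
    (∑' m, X ^ (m ^ 2 + e * m) * β m) * euler = ∑' r, X ^ (r ^ 2 + e * r) * α r :=
  (congrArg (· * euler) (tsum_congr fun m ↦ by rw [h m])).trans (tsum_bailey e α)

/-- A lacunary series `∑ᵣ εᵣ q ^ wᵣ`. -/
lemma hasSum_of_injective {w : ℕ → ℕ} (hw : w.Injective) (ε : ℕ → ℤ) :
    ∃ G : ℤ⟦X⟧, HasSum (fun r ↦ C (ε r) * X ^ w r) G ∧ (∀ r, coeff (w r) G = ε r) ∧
      ∀ n, n ∉ Set.range w → coeff n G = 0 := by
  have hs : Summable (fun r ↦ C (ε r) * X ^ w r : ℕ → ℤ⟦X⟧) :=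
    summable_of_X_pow_dvd w (fun n ↦ (Set.finite_Iic n).preimage hw.injOn)
      fun r ↦ dvd_mul_left _ _
  have hc : ∀ n, HasSum (fun r ↦ if n = w r then ε r else 0)
      (coeff n (∑' r, C (ε r) * X ^ w r : ℤ⟦X⟧)) := fun n ↦ by
    simpa only [coeff_C_mul, coeff_X_pow, mul_ite, mul_one, mul_zero]
      using (WithPiTopology.hasSum_iff_hasSum_coeff ℤ).1 hs.hasSum n
  refine ⟨_, hs.hasSum, fun r ↦ (hc (w r)).unique ?_, fun n hn ↦ (hc n).unique ?_⟩
  · convert hasSum_ite_eq r (ε r) using 2 with s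
    simp only [hw.eq_iff, eq_comm]
    grind
  · refine hasSum_zero.congr_fun fun r ↦ if_neg fun h ↦ hn ⟨r, h.symm⟩

theorem concaveSeries_one_one_mul_euler :
    concaveSeries 1 1 * euler = ∑' r, X ^ (r ^ 2 + 1 * r) * alphaOne r :=
  tsum_mul_euler_of_bailey 1 bailey_alphaOne

lemma summable_sq_add (e : ℕ) (f : ℕ → ℤ⟦X⟧) : Summable fun m ↦ X ^ (m ^ 2 + e * m) * f m :=
  summable_nat_of_X_pow_dvd fun _ ↦ Dvd.dvd.mul_right (pow_dvd_pow _ (le_sq_add _ _)) _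

/-- Writing `1 - q^(m+1) = (1 - q^(2m+1)) - q^(m+1) (1 - q^m)` splits the series into two Durfee
sums and the sum of the second Bailey pair. -/
theorem concaveSeries_zero_one_mul_euler :
    concaveSeries 0 1 * euler = 1 + X - X * ∑' r, X ^ (r ^ 2 + 1 * r) * alphaTwo r := by
  have h1 : HasSum (fun m ↦ X ^ (m ^ 2 + 0 * m) * (qInv m * qInv (m + 1))) (durfee 0 +
      X * durfee 1) := by
    refine ((hasSum_durfee 0).add ((hasSum_durfee 1).mul_left X)).congr_fun fun m ↦ ?_
    rw [add_zero, ← qInv_succ_mul m]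
    ring
  have h2 := ((summable_sq_add 1 fun m ↦
    qInv m * (1 - X ^ m) * qInv (m + 1) * geom (2 * m + 1)).hasSum.mul_left X)
  have h3 : concaveSeries 0 1 = _ := ((h1.sub h2).congr_fun fun m ↦ by
    have h := geom_mul (k := 2 * m + 1) (by omega)
    have h' := qInv_succ_mul m
    linear_combination (-X ^ (m ^ 2 + 0 * m) * qInv m * geom (2 * m + 1)) * h' +
      X ^ (m ^ 2 + 0 * m) * qInv m * qInv (m + 1) * h).tsum_eq
  have h4 := tsum_mul_euler_of_bailey 1 bailey_alphaTwo
  rw [h3, ← h4]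
  linear_combination durfee_mul_euler 0 + X * durfee_mul_euler 1

/-- With `x = q^(m+1)`, this rests on `(1-x)²/(1-x²) = (1-x) + x - 2x(1-x)/(1-x²)`: two Durfee sums,
the second lacking its term 1, and twice the sum of the Bailey pair. -/
theorem concaveSeries_one_two_mul_euler :
    (concaveSeries 1 2 + 1) * euler = 2 * (1 - ∑' r, X ^ (r ^ 2 + 0 * r) * alphaEven r) := by
  have h0 := (hasSum_nat_add_iff' 1).2 (hasSum_durfee 0)
  have hL := ((summable_sq_add 0 fun m ↦ qInv m ^ 2 * (1 - X ^ m) * geom (2 * m)).hasSum)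
  have hL1 := ((hasSum_nat_add_iff' 1).2 hL).mul_left 2
  have h3 : concaveSeries 1 2 = _ := ((((hasSum_durfee 1).add h0).sub hL1).congr_fun fun m ↦ by
    have h := geom_mul (k := 2 * m + 2) (by omega)
    have h' := qInv_succ_mul m
    rw [add_zero, ← h', show 2 * (m + 1) = 2 * m + 2 by ring]
    linear_combination (X ^ (m ^ 2 + 1 * m) * qInv (m + 1) ^ 2) * h).tsum_eq
  have h4 := tsum_mul_euler_of_bailey 0 bailey_alphaEven
  rw [h3, ← h4]
  simp
  linear_combination durfee_mul_euler 0 + durfee_mul_euler 1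

end ProductIdentities

section Gauss

open PowerSeries Finset
open scoped PowerSeries.WithPiTopology

/-! ### Gauss' identity for triangular numbers -/

/-- The series `∑ q ^ (r (r + 1) / 2)` weighted by a Bailey kernel. -/
noncomputable def triangleSum (e m : ℕ) : ℤ⟦X⟧ :=
  ∑ r ∈ range (m + 1), X ^ (r + 1).choose 2 * baileyKernel e m r

lemma triangleSum_eq (e : ℕ) {m N : ℕ} (h : m < N) :
    triangleSum e m = ∑ r ∈ range N, X ^ (r + 1).choose 2 * baileyKernel e m r :=
  sum_subset (range_subset_range.2 (Nat.succ_le_of_lt h)) fun r _ hr ↦ by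
    rw [baileyKernel_of_lt (by simpa using hr), mul_zero]

lemma choose_two_succ (r : ℕ) : (r + 1 + 1).choose 2 = (r + 1).choose 2 + r + 1 := by
  rw [Nat.choose_succ_succ' (r + 1) 1, Nat.choose_one_right]
  ring

lemma triangleSum_one (m : ℕ) : (1 - X ^ (2 * m + 1)) * triangleSum 1 m =
    (1 + X ^ m) * triangleSum 0 m - X ^ m * baileyKernel 0 m 0 := by
  have h0 : triangleSum 0 m = _ := triangleSum_eq 0 (N := m + 1 + 1) (by omega)
  rw [sum_range_succ'] at h0
  have h1 : (1 - X ^ (2 * m + 1)) * triangleSum 1 m = triangleSum 0 m +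
      X ^ m * ∑ r ∈ range (m + 1), X ^ (r + 1 + 1).choose 2 * baileyKernel 0 m (r + 1) := by
    rw [triangleSum, triangleSum, mul_sum, mul_sum, ← sum_add_distrib]
    refine sum_congr rfl fun r _ ↦ ?_
    rw [choose_two_succ]
    linear_combination X ^ (r + 1).choose 2 * baileyKernel_one m r
  rw [h1]
  simp only [zero_add, Nat.choose_succ_self, pow_zero, one_mul] at h0
  linear_combination - X ^ m * h0

lemma triangleSum_zero_succ (n : ℕ) : (1 - X ^ (2 * n + 2)) * triangleSum 0 (n + 1) =
    (1 + X ^ (n + 1)) * triangleSum 1 n + X ^ (n + 1) * baileyKernel 1 n 0 := by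
  have h0 : triangleSum 1 n = _ := triangleSum_eq 1 (N := n + 1 + 1) (by omega)
  rw [sum_range_succ'] at h0
  have h1 : (1 - X ^ (2 * n + 2)) * baileyKernel 0 (n + 1) 0 =
      (1 + X ^ (n + 1)) * baileyKernel 1 n 0 := by
    rw [baileyKernel_zero, baileyKernel_zero, add_zero, ← qInv_succ_mul n]
    ring
  have h2 : (1 - X ^ (2 * n + 2)) * ∑ r ∈ range (n + 1), X ^ (r + 1 + 1).choose 2 *
      baileyKernel 0 (n + 1) (r + 1) = ∑ r ∈ range (n + 1), X ^ (r + 1 + 1).choose 2 *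
        baileyKernel 1 n (r + 1) + X ^ (n + 1) * triangleSum 1 n := by
    rw [triangleSum, mul_sum, mul_sum, ← sum_add_distrib]
    refine sum_congr rfl fun r _ ↦ ?_
    rw [choose_two_succ]
    linear_combination X ^ (r + 1).choose 2 * baileyKernel_zero_succ' n r
  rw [triangleSum, sum_range_succ', mul_add, h2]
  simp only [zero_add, Nat.choose_succ_self, pow_zero, one_mul] at h0 ⊢
  linear_combination h1 - h0

lemma triangleSum_one_succ (n : ℕ) :
    (1 - X ^ (2 * n + 3)) * (1 - X ^ (2 * n + 2)) * triangleSum 1 (n + 1) =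
      (1 + X ^ (n + 1)) ^ 2 * triangleSum 1 n := by
  have h1 := triangleSum_one (n + 1)
  have h2 := triangleSum_zero_succ n
  have h3 : (1 - X ^ (2 * n + 2)) * baileyKernel 0 (n + 1) 0 =
      (1 + X ^ (n + 1)) * baileyKernel 1 n 0 := by
    rw [baileyKernel_zero, baileyKernel_zero, add_zero, ← qInv_succ_mul n]
    ring
  linear_combination (1 - X ^ (2 * n + 2)) * h1 + (1 + X ^ (n + 1)) * h2 - X ^ (n + 1) * h3

/-- A finite form of Gauss' identity. The recurrence in `m` passes from `e = 1` to `e = 0` and back,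
the boundary kernels cancelling. -/
lemma triangleSum_one_mul_qPoch (m : ℕ) :
    triangleSum 1 m * qPoch (2 * m + 1) = (∏ i ∈ range m, (1 + X ^ (i + 1))) ^ 2 := by
  induction m with
  | zero => simpa [triangleSum, baileyKernel, qPoch] using qInv_succ_mul 0
  | succ n ih =>
    rw [prod_range_succ, mul_pow, ← ih, show 2 * (n + 1) + 1 = 2 * n + 1 + 1 + 1 by ring, qPoch,
      prod_range_succ, prod_range_succ, ← qPoch]
    linear_combination qPoch (2 * n + 1) * triangleSum_one_succ n

lemma qPoch_mul_prod_one_add (m : ℕ) :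
    qPoch m * ∏ i ∈ range m, (1 + X ^ (i + 1)) = expand 2 two_ne_zero (qPoch m) := by
  rw [qPoch, map_prod, ← prod_mul_distrib]
  refine prod_congr rfl fun i _ ↦ ?_
  rw [map_sub, map_one, map_pow, expand_X]
  ring

/-- The generating function of triangular numbers. -/
noncomputable def triangleSeries : ℤ⟦X⟧ := ∑' r, X ^ (r + 1).choose 2

lemma le_choose_two (r : ℕ) : r ≤ (r + 1).choose 2 := by
  rw [Nat.choose_succ_succ' r 1, Nat.choose_one_right]
  exact Nat.le_add_right _ _

lemma hasSum_triangleSeries :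
    HasSum (fun r ↦ (X : ℤ⟦X⟧) ^ (r + 1).choose 2) triangleSeries :=
  (summable_nat_of_X_pow_dvd fun r ↦ pow_dvd_pow _ (le_choose_two r)).hasSum

lemma X_pow_dvd_triangleSeries_sub (n : ℕ) :
    X ^ n ∣ triangleSeries - ∑ r ∈ range n, X ^ (r + 1).choose 2 := by
  have h := hasSum_triangleSeries.summable
  rw [triangleSeries, ← h.sum_add_tsum_nat_add n, add_sub_cancel_left]
  have h' := (summable_nat_add_iff (f := fun r ↦ (X : ℤ⟦X⟧) ^ (r + 1).choose 2) n).2 h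
  refine X_pow_dvd_tsum (fun i ↦ ?_) h'
  have hi : n ≤ (i + n + 1).choose 2 := (Nat.le_add_left n i).trans (le_choose_two (i + n))
  exact pow_dvd_pow X hi

lemma X_pow_dvd_expand {n p : ℕ} (hp : p ≠ 0) {f : ℤ⟦X⟧} (h : X ^ n ∣ f) :
    X ^ n ∣ expand p hp f := by
  obtain ⟨g, rfl⟩ := h
  rw [map_mul, map_pow, expand_X, ← pow_mul]
  exact (pow_dvd_pow _ (Nat.le_mul_of_pos_left n (Nat.pos_of_ne_zero hp))).mul_right _

theorem triangleSeries_mul_euler :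
    triangleSeries * euler = expand 2 two_ne_zero euler ^ 2 := by
  refine eq_of_forall_X_pow_dvd_sub fun n ↦ ?_
  rw [← Ideal.mem_span_singleton, ← Ideal.Quotient.mk_eq_mk_iff_sub_mem]
  set φ := Ideal.Quotient.mk (Ideal.span {(X : ℤ⟦X⟧) ^ n}) with hφ
  have hφ' : ∀ a b, X ^ n ∣ a - b → φ a = φ b := fun a b h ↦ by
    rwa [hφ, Ideal.Quotient.mk_eq_mk_iff_sub_mem, Ideal.mem_span_singleton]
  have hP : ∀ k, n ≤ k → φ euler = φ (qPoch k) := fun k hk ↦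
    hφ' _ _ ((pow_dvd_pow X (by omega)).trans (X_pow_dvd_euler_sub_qPoch k))
  have hI : ∀ k, n ≤ k → φ (qInv k) * φ euler = 1 := fun k hk ↦ by
    rw [hP k hk, ← map_mul, qInv_mul_qPoch, map_one]
  -- Modulo `q^n`, for `r < n` both indices `2n - r` and `2n + r + 1` of the kernel are at least
  -- `n`, so `euler ^ 2` inverts it; for `r ≥ n` the triangular power vanishes.
  have hT : φ (triangleSum 1 (2 * n)) * φ euler ^ 2 = φ triangleSeries := by
    rw [hφ' _ _ (X_pow_dvd_triangleSeries_sub n), triangleSum,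
      show 2 * n + 1 = n + (n + 1) by ring, sum_range_add, map_add, map_sum, map_sum, map_sum]
    have hz : ∑ r ∈ range (n + 1), φ (X ^ (n + r + 1).choose 2 * baileyKernel 1 (2 * n) (n + r))
        = 0 := sum_eq_zero fun r _ ↦ by
      rw [← map_zero φ]
      refine hφ' _ _ ?_
      rw [sub_zero]
      exact (pow_dvd_pow X ((Nat.le_add_right n r).trans (le_choose_two _))).mul_right _
    rw [hz, add_zero, sum_mul]
    refine sum_congr rfl fun r hr ↦ ?_
    have hr := mem_range.1 hr
    rw [baileyKernel_of_le (by omega), map_mul, map_mul]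
    linear_combination φ (X ^ (r + 1).choose 2) * (φ euler * φ (qInv (2 * n + r + 1)) *
      hI (2 * n - r) (by omega) + hI (2 * n + r + 1) (by omega))
  have hE : φ (expand 2 two_ne_zero euler) = φ (expand 2 two_ne_zero (qPoch (2 * n))) :=
    hφ' _ _ (by
      rw [← map_sub]
      exact X_pow_dvd_expand _ ((pow_dvd_pow X (by omega)).trans
        (X_pow_dvd_euler_sub_qPoch (2 * n))))
  rw [map_mul, map_pow, hE, ← qPoch_mul_prod_one_add, ← map_pow, mul_pow,
    ← triangleSum_one_mul_qPoch, map_mul, map_mul, map_pow, ← hP _ (by omega), ← hP _ (by omega),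
    ← hT]
  ring

open Classical in
lemma coeff_triangleSeries (n : ℕ) :
    coeff n triangleSeries = if IsTriangular n then 1 else 0 := by
  have hinj : Function.Injective fun r ↦ (r + 1).choose 2 :=
    (strictMono_nat_of_lt_succ fun r ↦ by rw [choose_two_succ]; omega).injective
  obtain ⟨G, hG, h1, h2⟩ := hasSum_of_injective hinj fun _ ↦ 1
  have : triangleSeries = G := hasSum_triangleSeries.unique (hG.congr_fun fun r ↦ by simp)
  have htri : ∀ r, (r + 1).choose 2 = r * (r + 1) / 2 := fun r ↦ by
    rw [Nat.choose_two_right, Nat.add_sub_cancel, mul_comm]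
  rw [this]
  split_ifs with h
  · obtain ⟨k, rfl⟩ := h
    rw [← htri]
    exact h1 k
  · exact h2 n fun ⟨k, hk⟩ ↦ h ⟨k, by rw [← hk, ← htri]⟩

lemma coOne'_eq_coeff (n : ℕ) :
    coOne' n = coeff n (concaveSeries 1 1 - triangleSeries) := by
  rw [coOne', map_sub, coeff_triangleSeries, coOne_eq_coeff]
  split_ifs <;> simp

end Gauss

section Parity

open PowerSeries Finset
open scoped PowerSeries.WithPiTopology

/-! ### Parity of the coefficients -/

lemma two_dvd_iff {f : ℤ⟦X⟧} : 2 ∣ f ↔ ∀ n, Even (coeff n f) := by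
  have h2 : (2 : ℤ⟦X⟧) = C 2 := rfl
  constructor
  · rintro ⟨g, rfl⟩ n
    rw [h2, coeff_C_mul]
    exact even_two_mul _
  · intro h
    choose g hg using h
    refine ⟨mk g, ?_⟩
    ext n
    rw [h2, coeff_C_mul, coeff_mk, hg, two_mul]

/-- Frobenius over the field with two elements. -/
lemma two_dvd_sq_sub_expand (f : ℤ⟦X⟧) : 2 ∣ f ^ 2 - expand 2 two_ne_zero f := by
  have h : (expand 2 two_ne_zero (map (Int.castRingHom (ZMod 2)) f)) =
      (map (Int.castRingHom (ZMod 2)) f) ^ 2 := by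
    have := MvPowerSeries.map_frobenius_expand 2 two_ne_zero
      (f := map (Int.castRingHom (ZMod 2)) f)
    rwa [ZMod.frobenius_zmod, MvPowerSeries.map_id, RingHom.id_apply] at this
  rw [two_dvd_iff]
  intro n
  rw [← map_expand, ← map_pow] at h
  have hn := congrArg (coeff n) h
  rw [coeff_map, coeff_map, eq_intCast, eq_intCast, eq_comm, ← sub_eq_zero, ← Int.cast_sub,
    ZMod.intCast_eq_zero_iff_even, ← map_sub] at hn
  exact hn

/-- The exponents in `concaveSeries 1 1 * euler`. -/
lemma sq_add_two_mul_sq (r : ℕ) : r ^ 2 + 1 * r + 2 * ((r + 1) / 2) ^ 2 =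
    4 * pentagonal (-(Equiv.intEquivNat.symm r)) := by
  zify
  rcases Nat.even_or_odd' r with ⟨k, rfl | rfl⟩
  · have h : Equiv.intEquivNat.symm (2 * k) = k := by
      rw [Equiv.symm_apply_eq]
      rfl
    have := two_mul_natCast_pentagonal_neg (k : ℤ)
    rw [h, show ((2 * k : ℕ) + 1 : ℤ) / 2 = k by push_cast; omega]
    push_cast
    linarith
  · have h : Equiv.intEquivNat.symm (2 * k + 1) = Int.negSucc k := by
      rw [Equiv.symm_apply_eq]
      simp [Equiv.intEquivNat, Equiv.intEquivNatSumNat]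
    have := two_mul_natCast_pentagonal_neg (Int.negSucc k)
    rw [h, show ((2 * k + 1 : ℕ) + 1 : ℤ) / 2 = k + 1 by push_cast; omega]
    rw [Int.negSucc_eq] at this ⊢
    push_cast
    linarith

/-- Both series have coefficients `±1` exactly at four times the generalized pentagonal numbers; the
signs differ but are irrelevant mod 2. -/
theorem two_dvd_tsum_alphaOne_sub :
    2 ∣ ∑' r, X ^ (r ^ 2 + 1 * r) * alphaOne r - expand 4 four_ne_zero euler := by
  have hinj : Function.Injective fun r : ℕ ↦ 4 * pentagonal (-(Equiv.intEquivNat.symm r)) :=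
    fun r s h ↦ by
      simpa using h
  obtain ⟨G, hG, h1, h2⟩ := hasSum_of_injective hinj fun r ↦ (-1) ^ r
  have hT : ∑' r, X ^ (r ^ 2 + 1 * r) * alphaOne r = G := (hG.congr_fun fun r ↦ by
    rw [alphaOne, ← sq_add_two_mul_sq, pow_add, map_pow, map_neg, map_one]
    ring).tsum_eq
  rw [hT, two_dvd_iff]
  intro n
  rw [map_sub]
  by_cases hn : n ∈ Set.range fun r : ℕ ↦ 4 * pentagonal (-(Equiv.intEquivNat.symm r))
  · obtain ⟨r, rfl⟩ := hn
    rw [h1]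
    simp only [coeff_expand_mul, coeff_pentagonalSeries_pentagonal]
    refine Odd.sub_odd (Odd.pow (by decide)) ?_
    rcases Int.even_or_odd (-(Equiv.intEquivNat.symm r)) with h | h
    · simp [Int.negOnePow_even _ h]
    · simp [Int.negOnePow_odd _ h]
  · rw [h2 n hn, coeff_expand]
    split_ifs with hd
    · obtain ⟨m, rfl⟩ := hd
      rw [Nat.mul_div_cancel_left _ (by norm_num), coeff_pentagonalSeries_eq_zero]
      · simp
      · rintro ⟨j, rfl⟩
        exact hn ⟨Equiv.intEquivNat (-j), by simp⟩
    · simp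

theorem coeff_tsum_alphaOne_of_odd {n : ℕ} (hn : Odd n) :
    coeff n (∑' r, X ^ (r ^ 2 + 1 * r) * alphaOne r) = 0 := by
  have hs := (summable_sq_add 1 alphaOne).hasSum
  refine ((WithPiTopology.hasSum_iff_hasSum_coeff ℤ).1 hs n).unique
    (hasSum_zero.congr_fun fun r ↦ ?_)
  have : X ^ (r ^ 2 + 1 * r) * alphaOne r =
      C ((-1) ^ r) * X ^ (4 * pentagonal (-(Equiv.intEquivNat.symm r))) := by
    rw [alphaOne, ← sq_add_two_mul_sq, pow_add, map_pow, map_neg, map_one]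
    ring
  rw [this, coeff_C_mul, coeff_X_pow, if_neg, mul_zero]
  rintro rfl
  refine Nat.not_odd_iff_even.2 ?_ hn
  exact ⟨2 * pentagonal (-(Equiv.intEquivNat.symm r)), by ring⟩

/-- Both parts of the product with `euler` involve only even exponents, so its odd coefficients
vanish outright. -/
theorem exists_coOne'_eq_two_mul : ∃ G : ℤ⟦X⟧, (∀ n, coOne' n = 2 * coeff n G) ∧
    ∀ n, Odd n → Even (coeff n (G * euler)) := by
  set D := concaveSeries 1 1 - triangleSeries with hD
  have hDe : D * euler =
      ∑' r, X ^ (r ^ 2 + 1 * r) * alphaOne r - expand 2 two_ne_zero euler ^ 2 := by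
    rw [hD, sub_mul, concaveSeries_one_one_mul_euler, triangleSeries_mul_euler]
  have h4 : 2 ∣ expand 2 two_ne_zero euler ^ 2 - expand 4 four_ne_zero euler := by
    have := two_dvd_sq_sub_expand (expand 2 two_ne_zero euler)
    rwa [← expand_mul] at this
  have h2 : 2 ∣ D * euler := by
    have h := dvd_sub two_dvd_tsum_alphaOne_sub h4
    rwa [sub_sub_sub_cancel_right, ← hDe] at h
  obtain ⟨G, hG⟩ : 2 ∣ D := by
    have := h2.mul_right (durfee 0)
    rwa [mul_assoc, mul_comm euler, durfee_mul_euler, mul_one] at this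
  have hc : ∀ n f, coeff n (2 * f : ℤ⟦X⟧) = 2 * coeff n f := fun n f ↦ coeff_C_mul n f 2
  refine ⟨G, fun n ↦ by rw [coOne'_eq_coeff, ← hD, hG, hc], fun n hn ↦ ?_⟩
  have h0 : coeff n (D * euler) = 0 := by
    rw [hDe, map_sub, coeff_tsum_alphaOne_of_odd hn, ← map_pow,
      coeff_expand_of_not_dvd _ _ _ (fun h ↦ (Nat.not_even_iff_odd.2 hn) (even_iff_two_dvd.2 h)),
      sub_zero]
  rw [hG, mul_assoc, hc] at h0
  simp [(mul_eq_zero.1 h0).resolve_left two_ne_zero]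

/-- The identity concerns the series plus 1, so it gives `2G` only for `n > 0`. The constant term of
`G` is 1, so the evenness hypothesis rules out `n = 0`. -/
theorem exists_ce_eq_two_mul : ∃ G : ℤ⟦X⟧, (∀ n, Even (coeff n G) → ce n = 2 * coeff n G) ∧
    ∃ h : ℕ → ℕ, (∀ r, r ^ 2 ≤ h (r + 2)) ∧ ∀ n, n ∉ Set.range h → Even (coeff n (G * euler)) := by
  have hw : StrictMono fun r : ℕ ↦ r ^ 2 + (2 * (r / 2) ^ 2 + r / 2) :=
    strictMono_nat_of_lt_succ fun r ↦ by
      have h1 : r / 2 ≤ (r + 1) / 2 := by omega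
      have h2 := Nat.pow_le_pow_left h1 2
      have h3 : (r + 1) ^ 2 = r ^ 2 + 2 * r + 1 := by ring
      linarith
  obtain ⟨L, hL, h1, h2⟩ := hasSum_of_injective hw.injective
    fun r ↦ if r = 0 then 0 else (-1) ^ (r + 1)
  have hT : ∑' r, X ^ (r ^ 2 + 0 * r) * alphaEven r = L := (hL.congr_fun fun r ↦ by
    rw [alphaEven]
    split_ifs
    · simp
    · rw [map_pow, map_neg, map_one]
      ring).tsum_eq
  have he := concaveSeries_one_two_mul_euler
  rw [hT] at he
  have hG : concaveSeries 1 2 + 1 = 2 * ((1 - L) * durfee 0) := by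
    linear_combination durfee 0 * he - (concaveSeries 1 2 + 1) * durfee_mul_euler 0
  have hc : ∀ n f, coeff n (2 * f : ℤ⟦X⟧) = 2 * coeff n f := fun n f ↦ coeff_C_mul n f 2
  have hn : ∀ n, ce n + (if n = 0 then 1 else 0) = 2 * coeff n ((1 - L) * durfee 0) := fun n ↦ by
    rw [← hc, ← hG, map_add, ce_eq_coeff, coeff_one]
  have hL0 : coeff 0 L = 0 := h1 0
  -- Index 0 accounts for the term 1 of `1 - L`; index 1 is padding, so that the bound on `h` has
  -- the same form as for `coTwo`.
  refine ⟨(1 - L) * durfee 0, fun n hev ↦ ?_, fun r ↦ match r with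
    | 0 => 0
    | 1 => 0
    | r + 2 => r ^ 2 + (2 * (r / 2) ^ 2 + r / 2), fun r ↦ Nat.le_add_right _ _, fun n hn ↦ ?_⟩
  · rw [← hn, if_neg, add_zero]
    rintro rfl
    have hm : ∀ f g : ℤ⟦X⟧, coeff 0 (f * g) = coeff 0 f * coeff 0 g := fun f g ↦ by
      simp only [coeff_zero_eq_constantCoeff, map_mul]
    have hd : coeff 0 (durfee 0) = 1 := by
      have := congrArg (coeff 0) (durfee_mul_euler 0)
      have hp := coeff_pentagonalSeries_pentagonal ℤ 0
      rw [show pentagonal 0 = 0 from rfl] at hp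
      rw [hm, hp] at this
      simpa using this
    rw [hm, hd, map_sub, hL0] at hev
    simp at hev
  · rw [mul_assoc, durfee_mul_euler, mul_one, map_sub, coeff_one, if_neg fun h ↦ hn ⟨0, h.symm⟩,
      h2 n fun ⟨r, hr⟩ ↦ hn ⟨r + 2, hr⟩]
    simp

theorem exists_coTwo_eq : ∃ G : ℤ⟦X⟧, (∀ n, coTwo n = coeff n G) ∧
    ∃ h : ℕ → ℕ, (∀ r, r ^ 2 ≤ h (r + 2)) ∧ ∀ n, n ∉ Set.range h → Even (coeff n (G * euler)) := by
  have hw : StrictMono fun r : ℕ ↦ r ^ 2 + r + (2 * (r / 2) ^ 2 + 2 * (r / 2)) :=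
    strictMono_nat_of_lt_succ fun r ↦ by
      have h1 : r / 2 ≤ (r + 1) / 2 := by omega
      have h2 := Nat.pow_le_pow_left h1 2
      have h3 : (r + 1) ^ 2 = r ^ 2 + 2 * r + 1 := by ring
      linarith
  obtain ⟨L, hL, h1, h2⟩ := hasSum_of_injective hw.injective
    fun r ↦ if r = 0 then 0 else (-1) ^ (r + 1)
  have hT : ∑' r, X ^ (r ^ 2 + 1 * r) * alphaTwo r = L := (hL.congr_fun fun r ↦ by
    rw [alphaTwo]
    split_ifs
    · simp
    · rw [map_pow, map_neg, map_one]
      ring).tsum_eq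
  -- The values 0 and 1 of `h` account for `1 + X`; the others are the exponents of `L` shifted by
  -- the factor `X`.
  refine ⟨concaveSeries 0 1, coTwo_eq_coeff, fun r ↦ match r with
    | 0 => 0
    | 1 => 1
    | r + 2 => r ^ 2 + r + (2 * (r / 2) ^ 2 + 2 * (r / 2)) + 1, fun r ↦ ?_, fun n hn ↦ ?_⟩
  · show r ^ 2 ≤ r ^ 2 + r + (2 * (r / 2) ^ 2 + 2 * (r / 2)) + 1
    omega
  · rw [concaveSeries_zero_one_mul_euler, hT]
    match n, hn with
    | 0, hn => exact absurd ⟨0, rfl⟩ hn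
    | n + 1, hn =>
      have h1 : n ≠ 0 := by
        rintro rfl
        exact hn ⟨1, rfl⟩
      rw [map_sub, map_add, coeff_one, coeff_X, coeff_succ_X_mul,
        h2 n fun ⟨r, hr⟩ ↦ hn ⟨r + 2, congrArg (· + 1) hr⟩]
      simp [h1]

end Parity

section Counting

open PowerSeries Finset

/-! ### Counting even values -/

/-- The numbers `n` for which `2 k + 1` generalized pentagonal numbers are at most `n`. -/
def pentagonalBlock (k : ℕ) : Finset ℕ :=
  Ico (pentagonal (-k)) (pentagonal (-k) + (2 * k + 1))

lemma two_mul_pentagonal_neg (k : ℕ) : 2 * pentagonal (-k) = k * (3 * k + 1) := by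
  exact_mod_cast two_mul_natCast_pentagonal_neg k

lemma mem_pentagonalBlock {k n : ℕ} : n ∈ pentagonalBlock k ↔
    k * (3 * k + 1) ≤ 2 * n ∧ 2 * n < (k + 1) * (3 * k + 2) := by
  have h := two_mul_pentagonal_neg k
  have h' : (k + 1) * (3 * k + 2) = k * (3 * k + 1) + 4 * k + 2 := by ring
  rw [pentagonalBlock, mem_Ico, h', ← h]
  omega

lemma pentagonal_le_of_mem_block {k n : ℕ} (hn : n ∈ pentagonalBlock k) {j : ℤ}
    (hj : j ∈ Icc (-k : ℤ) k) : pentagonal j ≤ n := by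
  have h1 := (mem_pentagonalBlock.1 hn).1
  have h2 := two_mul_natCast_pentagonal j
  obtain ⟨hl, hr⟩ := mem_Icc.1 hj
  zify at h1 ⊢
  nlinarith

lemma lt_pentagonal_of_mem_block {k n : ℕ} (hn : n ∈ pentagonalBlock k) {j : ℤ}
    (hj : j ∉ Icc (-k : ℤ) k) : n < pentagonal j := by
  have h1 := (mem_pentagonalBlock.1 hn).2
  have h2 := two_mul_natCast_pentagonal j
  rw [mem_Icc, not_and_or, not_le, not_le] at hj
  zify at h1 ⊢
  rcases hj with hj | hj
  · have : j + 1 ≤ -(k : ℤ) := hj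
    nlinarith
  · have : (k : ℤ) + 1 ≤ j := hj
    nlinarith

lemma coeff_mul_euler {k n : ℕ} (hn : n ∈ pentagonalBlock k) (G : ℤ⟦X⟧) :
    coeff n (G * euler) =
      ∑ j ∈ Icc (-k : ℤ) k, (Int.negOnePow j : ℤ) * coeff (n - pentagonal j) G := by
  rw [mul_comm, coeff_mul, Nat.sum_antidiagonal_eq_sum_range_succ_mk]
  symm
  refine sum_of_injOn pentagonal pentagonal_injective.injOn (fun j hj ↦ ?_) (fun i _ hi ↦ ?_)
    fun j _ ↦ by rw [coeff_pentagonalSeries_pentagonal, Int.cast_id]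
  · exact mem_coe.2 (mem_range_succ_iff.2 (pentagonal_le_of_mem_block hn hj))
  · rw [coeff_pentagonalSeries_eq_zero, zero_mul]
    rintro ⟨j, rfl⟩
    refine hi ⟨j, ?_, rfl⟩
    by_contra hj
    have := lt_pentagonal_of_mem_block hn hj
    grind

/-- A sum of `2k + 1` odd terms is odd. -/
lemma exists_even_coeff {k n : ℕ} (hn : n ∈ pentagonalBlock k) {G : ℤ⟦X⟧}
    (hG : Even (coeff n (G * euler))) :
    ∃ j ∈ Icc (-k : ℤ) k, Even (coeff (n - pentagonal j) G) := by
  by_contra! h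
  rw [coeff_mul_euler hn, ← ZMod.intCast_eq_zero_iff_even, Int.cast_sum] at hG
  have h1 : ∀ j ∈ Icc (-k : ℤ) k,
      (((Int.negOnePow j : ℤ) * coeff (n - pentagonal j) G : ℤ) : ZMod 2) = 1 := fun j hj ↦ by
    rw [ZMod.intCast_eq_one_iff_odd]
    refine Odd.mul ?_ (Int.not_even_iff_odd.1 (h j hj))
    rcases Int.even_or_odd j with h | h
    · simp [Int.negOnePow_even _ h]
    · simp [Int.negOnePow_odd _ h]
  rw [sum_congr rfl h1, sum_const, nsmul_one, Int.card_Icc,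
    show ((k : ℤ) + 1 - -k).toNat = 2 * k + 1 by omega, ZMod.natCast_eq_zero_iff] at hG
  omega

lemma pairwiseDisjoint_pentagonalBlock (s : Set ℕ) : s.PairwiseDisjoint pentagonalBlock := by
  intro k _ l _ hkl
  refine disjoint_left.2 fun n hk hl ↦ ?_
  rw [mem_pentagonalBlock] at hk hl
  rcases lt_or_gt_of_ne hkl with h | h
  · nlinarith
  · nlinarith

lemma card_pentagonalBlock (k : ℕ) : #(pentagonalBlock k) = 2 * k + 1 := by
  simp [pentagonalBlock]

lemma lt_of_mem_block {k K n : ℕ} (hk : k ≤ K) (hn : n ∈ pentagonalBlock k) :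
    2 * n < (K + 1) * (3 * K + 2) :=
  (mem_pentagonalBlock.1 hn).2.trans_le (by gcongr)

/-- Each `n` in `A` is sent to an even coefficient `n - ω_j` together with `j`. The pair recovers
`n`, and `j` takes at most `2K + 1` values. -/
lemma card_le_E_mul {f : ℕ → ℤ} {r a : ℤ} {G : ℤ⟦X⟧}
    (hf : ∀ n, Even (coeff n G) → f n ≡ r [ZMOD a]) {X : ℝ} {K : ℕ}
    (hX : ((K + 1) * (3 * K + 2) : ℝ) ≤ 2 * X) {A : Finset ℕ}
    (hA : A ⊆ (range (K + 1)).biUnion pentagonalBlock)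
    (hG : ∀ n ∈ A, Even (coeff n (G * euler))) : #A ≤ E f r a X * (2 * K + 1) := by
  have hfin : {n : ℕ | (n : ℝ) < X ∧ f n ≡ r [ZMOD a]}.Finite :=
    (Set.finite_Iic ⌊X⌋₊).subset fun n hn ↦ Nat.le_floor hn.1.le
  have hex : ∀ n ∈ A, ∃ j ∈ Icc (-K : ℤ) K, pentagonal j ≤ n ∧ (n : ℝ) < X ∧
      Even (coeff (n - pentagonal j) G) := fun n hn ↦ by
    obtain ⟨k, hk, hnk⟩ := mem_biUnion.1 (hA hn)
    have hkK := mem_range_succ_iff.1 hk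
    obtain ⟨j, hj, he⟩ := exists_even_coeff hnk (hG n hn)
    refine ⟨j, Icc_subset_Icc (by omega) (by omega) hj, pentagonal_le_of_mem_block hnk hj, ?_, he⟩
    have : (2 * n : ℝ) < (K + 1) * (3 * K + 2) := by exact_mod_cast lt_of_mem_block hkK hnk
    linarith
  choose! j hj hle hlt hev using hex
  have hcard : #A ≤ #(hfin.toFinset ×ˢ Icc (-K : ℤ) K) := by
    refine card_le_card_of_injOn (fun n ↦ (n - pentagonal (j n), j n)) (fun n hn ↦ ?_) ?_
    · refine mem_coe.2 (mem_product.2 ⟨hfin.mem_toFinset.2 ⟨?_, hf _ (hev n hn)⟩, hj n hn⟩)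
      exact (Nat.cast_le.2 (Nat.sub_le _ _)).trans_lt (hlt n hn)
    · intro n hn m hm h
      simp only [Prod.mk.injEq] at h
      have h1 := hle n hn
      have h2 := hle m hm
      rw [h.2] at h1 h
      omega
  rw [card_product, Int.card_Icc, show ((K : ℤ) + 1 - -K).toNat = 2 * K + 1 by omega] at hcard
  rwa [E, Set.ncard_eq_toFinset_card _ hfin]

lemma sum_card_pentagonalBlock (K : ℕ) :
    #((range (K + 1)).biUnion pentagonalBlock) = (K + 1) ^ 2 := by
  rw [card_biUnion (by exact pairwiseDisjoint_pentagonalBlock _)]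
  simp only [card_pentagonalBlock]
  induction K with
  | zero => rfl
  | succ K ih =>
    rw [sum_range_succ, ih]
    ring

-- An exceptional exponent of index at least `2K + 4` is at least `(2K+2)²`, beyond all the blocks.
open Classical in
lemma card_blocks_sdiff_range {h : ℕ → ℕ} (hh : ∀ r, r ^ 2 ≤ h (r + 2)) (K : ℕ) : (K + 1) ^ 2 ≤
    #{n ∈ (range (K + 1)).biUnion pentagonalBlock | n ∉ Set.range h} + (2 * K + 4) := by
  rw [← sum_card_pentagonalBlock,
    ← card_filter_add_card_filter_not (s := (range (K + 1)).biUnion pentagonalBlock)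
      (fun n ↦ n ∉ Set.range h)]
  refine Nat.add_le_add_left ?_ _
  have : {n ∈ (range (K + 1)).biUnion pentagonalBlock | ¬ n ∉ Set.range h} ⊆
      (range (2 * K + 4)).image h := fun n hn ↦ by
    obtain ⟨hn, hr⟩ := mem_filter.1 hn
    obtain ⟨r, rfl⟩ := not_not.1 hr
    obtain ⟨k, hk, hnk⟩ := mem_biUnion.1 hn
    have hlt := lt_of_mem_block (mem_range_succ_iff.1 hk) hnk
    refine mem_image_of_mem h (mem_range.2 ?_)
    by_contra! hr
    obtain ⟨s, rfl⟩ := Nat.exists_eq_add_of_le' (show 2 ≤ r by omega)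
    have := hh s
    have hs : 2 * K + 2 ≤ s := by omega
    nlinarith
  simpa using (card_le_card this).trans card_image_le

lemma card_odd_pentagonalBlock (k : ℕ) : k ≤ #{n ∈ pentagonalBlock k | Odd n} := by
  set p := pentagonal (-k) with hp
  have : #((range k).image fun i ↦ 2 * (p / 2 + i) + 1) = k := by
    rw [card_image_of_injective _ fun i j h ↦ by simpa using h, card_range]
  refine this.symm.le.trans (card_le_card fun n hn ↦ ?_)
  obtain ⟨i, hi, rfl⟩ := mem_image.1 hn
  have := mem_range.1 hi
  refine mem_filter.2 ⟨?_, ⟨_, rfl⟩⟩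
  rw [pentagonalBlock, mem_Ico, ← hp]
  omega

lemma card_odd_blocks (K : ℕ) :
    K * (K + 1) ≤ 2 * #{n ∈ (range (K + 1)).biUnion pentagonalBlock | Odd n} := by
  rw [filter_biUnion, card_biUnion fun k hk l hl hkl ↦
    disjoint_filter_filter (pairwiseDisjoint_pentagonalBlock Set.univ trivial trivial hkl)]
  refine le_trans ?_ (Nat.mul_le_mul_left 2 (sum_le_sum fun k _ ↦ card_odd_pentagonalBlock k))
  rw [mul_comm 2, sum_range_id_mul_two, Nat.add_sub_cancel, mul_comm]

lemma lt_E_of_card {f : ℕ → ℤ} {r a : ℤ} {G : ℤ⟦X⟧}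
    (hf : ∀ n, Even (coeff n G) → f n ≡ r [ZMOD a]) {p : ℕ → Prop} [DecidablePred p]
    (hp : ∀ n, p n → Even (coeff n (G * euler)))
    (hcard : ∀ K, 3 ≤ K →
      K * (2 * K + 1) ≤ 4 * #{n ∈ (range (K + 1)).biUnion pentagonalBlock | p n})
    {X : ℝ} (hX : 30 ≤ X) : (√(24 * X + 1) - 11) / 24 < E f r a X := by
  set s := √(24 * X + 1) with hs
  have hs2 : s ^ 2 = 24 * X + 1 := Real.sq_sqrt (by linarith)
  have hs0 : 0 ≤ s := Real.sqrt_nonneg _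
  have hs23 : 23 ≤ s := by nlinarith
  -- The largest `K` whose blocks stay below `X`: `(K+1)(3K+2) ≤ 2X` amounts to `(6K+5)² ≤ 24X + 1`.
  set K := ⌊(s - 5) / 6⌋₊ with hK
  have hK1 : (K : ℝ) ≤ (s - 5) / 6 := Nat.floor_le (by linarith)
  have hK2 : (s - 5) / 6 < K + 1 := Nat.lt_floor_add_one _
  have hK3 : 3 ≤ K := Nat.le_floor (by push_cast; linarith)
  have hbound := card_le_E_mul hf (X := X) (K := K) (by nlinarith)
    (filter_subset p _) fun n hn ↦ hp n (mem_filter.1 hn).2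
  have hKE : K ≤ 4 * E f r a X :=
    Nat.le_of_mul_le_mul_right ((hcard K hK3).trans (by linarith)) (show 0 < 2 * K + 1 by omega)
  have : (K : ℝ) ≤ 4 * E f r a X := by exact_mod_cast hKE
  linarith

lemma lt_E_of_lacunary {f : ℕ → ℤ} {r a : ℤ} {G : ℤ⟦X⟧}
    (hf : ∀ n, Even (coeff n G) → f n ≡ r [ZMOD a]) {h : ℕ → ℕ} (hh : ∀ r, r ^ 2 ≤ h (r + 2))
    (hG : ∀ n, n ∉ Set.range h → Even (coeff n (G * euler))) {X : ℝ} (hX : 100 ≤ X) :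
    1 / 10 * √X < E f r a X := by
  classical
  refine lt_of_le_of_lt ?_ (lt_E_of_card hf hG (fun K hK ↦ ?_) (by linarith : 30 ≤ X))
  · have h1 : 4 * √X ≤ √(24 * X + 1) := by
      refine Real.le_sqrt_of_sq_le ?_
      rw [mul_pow, Real.sq_sqrt (by linarith)]
      linarith
    have h2 : 10 ≤ √X := Real.le_sqrt_of_sq_le (by linarith)
    linarith
  · have := card_blocks_sdiff_range hh K
    nlinarith

end Counting

end ConcaveComposition

/-! ### Assembly of the three bounds -/

theorem theorem1 :
    (∃ c : ℝ, 0 < c ∧ ∀ᶠ X : ℝ in Filter.atTop,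
      (ConcaveComposition.E ConcaveComposition.ce 0 4 X : ℝ) > c * Real.sqrt X) ∧
    (∃ c α : ℝ, 0 < c ∧ 0 < α ∧ α < 1 ∧ ∀ᶠ X : ℝ in Filter.atTop,
      (ConcaveComposition.E ConcaveComposition.coOne' 0 4 X : ℝ) >
        (X * (Real.log X) ^ α - c * X) /
          ((Real.sqrt (24 * X + 1) + 1) * (Real.log X) ^ α)) ∧
    (∃ c : ℝ, 0 < c ∧ ∀ᶠ X : ℝ in Filter.atTop,
      (ConcaveComposition.E ConcaveComposition.coTwo 0 2 X : ℝ) > c * Real.sqrt X) := by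
  have hmod : ∀ x : ℤ, Even x → 2 * x ≡ 0 [ZMOD 4] := by
    rintro _ ⟨y, rfl⟩
    exact Int.modEq_zero_iff_dvd.2 ⟨y, by ring⟩
  refine ⟨⟨1 / 10, by norm_num, ?_⟩, ⟨10, 1 / 2, by norm_num, by norm_num, by norm_num, ?_⟩,
    ⟨1 / 10, by norm_num, ?_⟩⟩
  · obtain ⟨G, hce, h, hh, hG⟩ := ConcaveComposition.exists_ce_eq_two_mul
    filter_upwards [Filter.eventually_ge_atTop 100] with X hX
    exact ConcaveComposition.lt_E_of_lacunary (fun n hn ↦ hce n hn ▸ hmod _ hn) hh hG hX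
  · obtain ⟨G, hco, hG⟩ := ConcaveComposition.exists_coOne'_eq_two_mul
    filter_upwards [Filter.eventually_ge_atTop 30] with X hX
    have hlt := ConcaveComposition.lt_E_of_card (f := ConcaveComposition.coOne')
      (fun n hn ↦ hco n ▸ hmod _ hn) hG (fun K _ ↦ by
        have := ConcaveComposition.card_odd_blocks K
        nlinarith) hX
    refine lt_of_le_of_lt ?_ hlt
    set s := √(24 * X + 1)
    have hs2 : s ^ 2 = 24 * X + 1 := Real.sq_sqrt (by linarith)
    have hs0 : 0 ≤ s := Real.sqrt_nonneg _
    have hlog : 0 < Real.log X := Real.log_pos (by linarith)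
    set L := Real.log X ^ (1 / 2 : ℝ) with hL
    have hL0 : 0 < L := Real.rpow_pos_of_pos hlog _
    have hL2 : L ^ 2 = Real.log X := by
      rw [hL, ← Real.sqrt_eq_rpow, Real.sq_sqrt hlog.le]
    have hLs : L ≤ s - 1 := by
      have h1 : Real.log X ≤ X := (Real.log_le_sub_one_of_pos (by linarith)).trans (by linarith)
      have h2 : 10 ≤ s := by nlinarith
      refine (sq_le_sq₀ hL0.le (by linarith)).1 ?_
      nlinarith
    -- As `24X = (s-1)(s+1)`, the target is `((s-1) - 10(s-1)/L)/24`. With `c = 10` it is at most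
    -- `(s-11)/24` exactly when `L ≤ s - 1`.
    rw [div_le_iff₀ (by positivity)]
    have hX' : X = (s - 1) * (s + 1) / 24 := by linarith
    rw [hX']
    nlinarith [mul_nonneg (sub_nonneg.2 hLs) (by linarith : 0 ≤ s + 1)]
  · obtain ⟨G, hco, h, hh, hG⟩ := ConcaveComposition.exists_coTwo_eq
    filter_upwards [Filter.eventually_ge_atTop 100] with X hX
    exact ConcaveComposition.lt_E_of_lacunary (fun n hn ↦ by
      rw [hco]
      exact Int.modEq_zero_iff_dvd.2 hn.two_dvd) hh hG hX
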